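/- Let $A\in\mathbb R^{n\times n}$ and $B\in\mathbb R^{n\times m}$, and let $\mu$ be the degree of the minimal polynomial of $A$. For an integer $k\ge 1$ and a real $\alpha$ with $k-1<\alpha\le k$, consider the Caputo fractional differential system $$({}^{C}D^{\alpha}_{0+}x)(t)=Ax(t)+Bu(t),\qquad x^{(j)}(0)=x_{0j}\quad(0\le j\le k-1),$$ where ${}^{C}D^{\alpha}_{0+}x=\frac{d^k}{dt^k}\,I^{k-\alpha}_{0+}\Big[x-\sum_{j=0}^{k-1}\frac{x^{(j)}(0)}{j!}t^j\Big]$, $I^{\beta}_{0+}$ is the Riemann–Liouville integral of order $\beta$ ($I^0_{0+}$ being the identity), and the admissible controls $u$ are the bounded piecewise continuous ones. A trajectory on $[0,T]$ is a function $x\in C^{k-1}([0,T];\mathbb R^n)$ with the given initial conditions for which $I^{k-\alpha}_{0+}[\,\cdots]$ is also in $C^{k-1}([0,T];\mathbb R^n)$ and which satisfies the equation at every point of $(0,T)$ at which $u$ is continuous. The system is controllable on $[0,T]$ ($0<T<\infty$) if for all $x_{00},\dots,x_{0,k-1}\in\mathbb R^n$ and every $x^*\in\mathbb R^n$ there is an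 admissible control $u:[0,T]\to\mathbb R^m$ with a trajectory $x$ from these initial conditions such that $x(T)=x^*$. Put $$\Phi_\alpha(t)=\sum_{\ell=0}^{\infty}\frac{A^{\ell}t^{\alpha\ell}}{\Gamma(\alpha\ell+\alpha)},\qquad G_\alpha(T)=\int_0^T\Phi_\alpha(\tau)BB^{\top}\Phi_\alpha^{\top}(\tau)\,d\tau ,$$ where $B^{\top}$ and $\Phi_\alpha^{\top}$ denote transposes. Then, for every such $k$ and $\alpha$ and every finite $T>0$, the following are equivalent: (a) the system is controllable on $[0,T]$; (a') the system is controllable on $[0,T']$ for every finite $T'>0$; (1) $\operatorname{rank}[B,AB,\dots,A^{\mu-1}B]=n$; (2) $\operatorname{rank}[\lambda I_n-A,\,B]=n$ for every $\lambda\in\sigma(A)$, the set of complex eigenvalues of $A$; (3) $G_\alpha(T)$ is positive definite; (3') $G_\alpha(T')$ is positive definite for every finite $T'>0$. Consequently controllability depends neither on $\alpha$ nor on the interval: for all $k,\alpha,T$ and $k',\alpha',T'$ as above, the system of order $\alpha$ is controllable on $[0,T]$ if and only if the system of order $\alpha'$ is controllable on $[0,T']$. -/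

import Mathlib

open Set Filter Topology

noncomputable section

namespace CaputoControl

/-- Riemann-Liouville fractional integral of order `β ≥ 0` based at `0`;
the integral of order `0` is the identity. -/
def rlIntegral {E : Type*} [NormedAddCommGroup E] [NormedSpace ℝ E]
    (β : ℝ) (f : ℝ → E) (t : ℝ) : E :=
  if β = 0 then f t
  else (Real.Gamma β)⁻¹ • ∫ s in (0 : ℝ)..t, (t - s) ^ (β - 1) • f s

/-- The fractional integral of order `k - α` of `x` minus its Taylor polynomial of degree `k - 1`
at `0`. Derivatives at `0` are one-sided. The `k`-th derivative of this function is the Caputo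
derivative of `x` of order `α`, for `k - 1 < α ≤ k`. -/
def caputoPrimitive {E : Type*} [NormedAddCommGroup E] [NormedSpace ℝ E]
    (k : ℕ) (α T : ℝ) (x : ℝ → E) : ℝ → E :=
  rlIntegral ((k : ℝ) - α) (fun s => x s - taylorWithinEval x (k - 1) (Icc 0 T) 0 s)

/-- `x`, given on `[0, T]`, has at the point `t` the Caputo derivative `v` of order `α`
(where `k - 1 < α ≤ k` and `1 ≤ k`). -/
def HasCaputoDerivAt {E : Type*} [NormedAddCommGroup E] [NormedSpace ℝ E]
    (k : ℕ) (α T : ℝ) (x : ℝ → E) (v : E) (t : ℝ) : Prop :=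
  HasDerivAt (iteratedDerivWithin (k - 1) (caputoPrimitive k α T x) (Icc 0 T)) v t

/-- Admissible controls on `[0, T]`: bounded and piecewise continuous (continuous outside a finite
set, with finite one-sided limits everywhere). -/
structure IsAdmissible {m : ℕ} (T : ℝ) (u : ℝ → Fin m → ℝ) : Prop where
  bounded : ∃ M : ℝ, ∀ t ∈ Icc 0 T, ‖u t‖ ≤ M
  continuousAt : ∃ S : Finset ℝ, ∀ t ∈ Ioo 0 T, t ∉ S → ContinuousAt u t
  rightLimit : ∀ t ∈ Ico 0 T, ∃ l, Tendsto u (𝓝[>] t) (𝓝 l)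
  leftLimit : ∀ t ∈ Ioc 0 T, ∃ l, Tendsto u (𝓝[<] t) (𝓝 l)

/-- `x` is on `[0, T]` a state trajectory of the Caputo system of order `α` with dynamics `A`,
control matrix `B`, control `u` and initial conditions `x⁽ʲ⁾(0) = x₀ⱼ`, `j = 0, …, k - 1`.
The equation is required at every point of `(0, T)` where the control is continuous. -/
structure IsTrajectory {n m : ℕ} (k : ℕ) (α : ℝ) (A : Matrix (Fin n) (Fin n) ℝ)
    (B : Matrix (Fin n) (Fin m) ℝ) (T : ℝ) (u : ℝ → Fin m → ℝ) (x₀ : Fin k → Fin n → ℝ)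
    (x : ℝ → Fin n → ℝ) : Prop where
  contDiffOn : ContDiffOn ℝ ((k - 1 : ℕ) : WithTop ℕ∞) x (Icc 0 T)
  initial : ∀ j : Fin k, iteratedDerivWithin j x (Icc 0 T) 0 = x₀ j
  contDiffOn_primitive :
    ContDiffOn ℝ ((k - 1 : ℕ) : WithTop ℕ∞) (caputoPrimitive k α T x) (Icc 0 T)
  equation : ∀ t ∈ Ioo 0 T, ContinuousAt u t →
    HasCaputoDerivAt k α T x (A.mulVec (x t) + B.mulVec (u t)) t

/-- Controllability on `[0, T]`: from any initial conditions, any prescribed state can be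
attained at time `T` by means of an admissible control. -/
def Controllable {n m : ℕ} (k : ℕ) (α : ℝ) (A : Matrix (Fin n) (Fin n) ℝ)
    (B : Matrix (Fin n) (Fin m) ℝ) (T : ℝ) : Prop :=
  ∀ (x₀ : Fin k → Fin n → ℝ) (target : Fin n → ℝ),
    ∃ (u : ℝ → Fin m → ℝ) (x : ℝ → Fin n → ℝ),
      IsAdmissible T u ∧ IsTrajectory k α A B T u x₀ x ∧ x T = target

/-- The block matrix `[B, A B, …, A ^ (μ - 1) B]`, where `μ` is the degree of the minimal
polynomial of `A`. -/
def controllabilityMatrix {n m : ℕ} (A : Matrix (Fin n) (Fin n) ℝ)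
    (B : Matrix (Fin n) (Fin m) ℝ) :
    Matrix (Fin n) (Fin (minpoly ℝ A).natDegree × Fin m) ℝ :=
  Matrix.of fun i p => (A ^ (p.1 : ℕ) * B) i p.2

/-- The block matrix `[λ I - A, B]` for a complex number `λ`. -/
def pbhMatrix {n m : ℕ} (A : Matrix (Fin n) (Fin n) ℝ) (B : Matrix (Fin n) (Fin m) ℝ) (z : ℂ) :
    Matrix (Fin n) (Fin n ⊕ Fin m) ℂ :=
  Matrix.fromCols (z • (1 : Matrix (Fin n) (Fin n) ℂ) - A.map Complex.ofReal)
    (B.map Complex.ofReal)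

/-- The Mittag-Leffler matrix function `Φ_α(t) = ∑ A ^ l t ^ (α l) / Γ(α l + α)`, that is,
`E_{α,α}(A t ^ α)`. -/
def evolution {n : ℕ} (α : ℝ) (A : Matrix (Fin n) (Fin n) ℝ) (t : ℝ) :
    Matrix (Fin n) (Fin n) ℝ :=
  ∑' l : ℕ, (t ^ (α * (l : ℝ)) / Real.Gamma (α * (l : ℝ) + α)) • A ^ l

/-- The controllability Gramian, the entrywise integral over `[0, T]` of `Φ_α B Bᵀ Φ_αᵀ`. -/
def gramian {n m : ℕ} (α : ℝ) (A : Matrix (Fin n) (Fin n) ℝ) (B : Matrix (Fin n) (Fin m) ℝ)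
    (T : ℝ) : Matrix (Fin n) (Fin n) ℝ :=
  Matrix.of fun i j => ∫ τ in (0 : ℝ)..T,
    (evolution α A τ * B * B.transpose * (evolution α A τ).transpose) i j

end CaputoControl

end

/-!
All the conditions are compared with the algebraic one: no nonzero `v` satisfies `vᵀ A ^ l B = 0`
for all `l`. For the rank of the controllability matrix this is reduction of powers of `A` modulo
the minimal polynomial (`rank_controllabilityMatrix_iff`).

The Gramian has the quadratic form `∫ ‖xᵀ Φ_α(τ) B‖² dτ`, and `xᵀ Φ_α(τ) B` is a power series in
`τ ^ α` with coefficients `xᵀ A ^ l B / Γ(α l + α)`; it vanishes on `[0, T]` only if all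
coefficients do (`posDef_gramian_iff`).

*Sufficiency* (`controllable_of_rank`). A continuous solution of the Volterra equation
`x = ∑ j < k, t ^ j / j! x₀ⱼ + I ^ α (A x + B u)` is a trajectory, by the semigroup law
`I ^ a I ^ b = I ^ (a + b)` of fractional integration. Free motions and the responses to the
controls `t ^ p / p! b` are explicit Mittag-Leffler series. The states reachable from zero form a
subspace, and a functional `v` vanishing on it satisfies
`∑ l, T ^ (α l + α + p) / Γ(α l + α + p + 1) vᵀ A ^ l B b = 0` for all `p`. As `p → ∞` each term
dominates all later ones, so `vᵀ A ^ l B = 0` for all `l`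
(`eq_zero_of_mittagLeffler_nat_shift_eq_zero`). Polynomial controls thus suffice, and neither the
singularity of the resolvent kernel for `α < 1` nor the formula of variation of constants enters.

*Necessity* (`rank_pbhMatrix_of_controllable`). If the Hautus condition fails at `z`, there is a
left eigenvector `w ≠ 0` of `A` with `wᵀ B = 0`. Along a trajectory with zero initial values the
scalar `wᵀ x` solves the homogeneous Caputo equation of order `α` with coefficient `z`, whatever the
control, and hence vanishes (`eq_zero_of_caputo_homogeneous`): its `(k - 1)`-st derivative `g`
satisfies `g = z I ^ α g`. The cycle is closed by
`rank_controllabilityMatrix_of_rank_pbhMatrix`: a vector annihilated by all `A ^ l B` yields a left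
eigenvector over `ℂ` with the same property.
-/

open MeasureTheory

namespace CaputoControl

/-! ### Riemann-Liouville integrals -/

section RiemannLiouville

variable {E F : Type*} [NormedAddCommGroup E] [NormedSpace ℝ E]
  [NormedAddCommGroup F] [NormedSpace ℝ F]

theorem integral_sub_rpow_mul_rpow {a b t : ℝ} (ha : 0 < a) (hb : 0 < b) (ht : 0 < t) :
    ∫ s in (0 : ℝ)..t, (t - s) ^ (a - 1) * s ^ (b - 1) =
      Real.Gamma a * Real.Gamma b / Real.Gamma (a + b) * t ^ (a + b - 1) := by
  have h1 := Complex.betaIntegral_scaled (b : ℂ) (a : ℂ) ht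
  have h2 := Complex.Gamma_mul_Gamma_eq_betaIntegral (s := (b : ℂ)) (t := (a : ℂ))
    (by simpa using hb) (by simpa using ha)
  have h3 : Real.Gamma (a + b) ≠ 0 := (Real.Gamma_pos_of_pos (by linarith)).ne'
  have h3' : Complex.Gamma ((b : ℂ) + a) ≠ 0 := by
    rw [add_comm, ← Complex.ofReal_add, Complex.Gamma_ofReal]; exact_mod_cast h3
  have h4 : Complex.betaIntegral b a =
      ((Real.Gamma a * Real.Gamma b / Real.Gamma (a + b) : ℝ) : ℂ) := by
    rw [eq_comm, Complex.ofReal_div, div_eq_iff (by exact_mod_cast h3)]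
    push_cast
    rw [← Complex.Gamma_ofReal, ← Complex.Gamma_ofReal, ← Complex.Gamma_ofReal, mul_comm, h2]
    push_cast
    rw [add_comm, mul_comm]
  apply Complex.ofReal_injective
  rw [← intervalIntegral.integral_ofReal, Complex.ofReal_mul, ← h4, Complex.ofReal_cpow ht.le]
  rw [mul_comm]
  push_cast
  rw [add_comm (a : ℂ), ← h1]
  apply intervalIntegral.integral_congr
  intro s hs
  rw [uIcc_of_le ht.le] at hs
  have h5 : 0 ≤ t - s := by linarith [hs.2]
  simp only
  rw [mul_comm, Complex.ofReal_cpow hs.1, Complex.ofReal_cpow h5]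
  push_cast
  rfl

theorem intervalIntegrable_sub_rpow {b : ℝ} (hb : 0 < b) (t : ℝ) :
    IntervalIntegrable (fun s => (t - s) ^ (b - 1)) volume 0 t := by
  have h := (intervalIntegral.intervalIntegrable_rpow' (a := 0) (b := t)
    (r := b - 1) (by linarith)).comp_sub_left t
  simpa using h.symm

theorem intervalIntegrable_sub_rpow_smul {b t : ℝ} (hb : 0 < b) {f : ℝ → E} (ht : 0 ≤ t)
    (hf : ContinuousOn f (Icc 0 t)) :
    IntervalIntegrable (fun s => (t - s) ^ (b - 1) • f s) volume 0 t := by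
  apply (intervalIntegrable_sub_rpow hb t).smul_continuousOn
  rwa [uIcc_of_le ht]

theorem rlIntegral_zero_order (f : ℝ → E) : rlIntegral 0 f = f := by
  ext t; simp [rlIntegral]

theorem rlIntegral_of_pos {b : ℝ} (hb : 0 < b) (f : ℝ → E) (t : ℝ) :
    rlIntegral b f t = (Real.Gamma b)⁻¹ • ∫ s in (0 : ℝ)..t, (t - s) ^ (b - 1) • f s := by
  simp [rlIntegral, hb.ne']

theorem rlIntegral_congr {T b : ℝ} {f g : ℝ → E} (h : EqOn f g (Icc 0 T)) :
    EqOn (rlIntegral b f) (rlIntegral b g) (Icc 0 T) := by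
  intro t ht
  unfold rlIntegral
  split_ifs with hb
  · exact h ht
  · congr 1
    apply intervalIntegral.integral_congr
    intro s hs
    rw [uIcc_of_le ht.1] at hs
    simp only
    rw [h ⟨hs.1, hs.2.trans ht.2⟩]

theorem rlIntegral_one (f : ℝ → E) (t : ℝ) : rlIntegral 1 f t = ∫ s in (0 : ℝ)..t, f s := by
  simp [rlIntegral]

theorem rlIntegral_at_zero {b : ℝ} (hb : 0 < b) (f : ℝ → E) : rlIntegral b f 0 = 0 := by
  simp [rlIntegral_of_pos hb]

theorem rlIntegral_add {b t : ℝ} (hb : 0 ≤ b) (ht : 0 ≤ t) {f g : ℝ → E}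
    (hf : ContinuousOn f (Icc 0 t)) (hg : ContinuousOn g (Icc 0 t)) :
    rlIntegral b (fun s => f s + g s) t = rlIntegral b f t + rlIntegral b g t := by
  rcases hb.eq_or_lt with rfl | hb
  · simp [rlIntegral]
  · simp only [rlIntegral_of_pos hb, smul_add]
    rw [intervalIntegral.integral_add (intervalIntegrable_sub_rpow_smul hb ht hf)
      (intervalIntegrable_sub_rpow_smul hb ht hg), smul_add]

theorem rlIntegral_clm_comp [CompleteSpace E] [CompleteSpace F] (L : E →L[ℝ] F) {b t : ℝ}
    (hb : 0 ≤ b) (ht : 0 ≤ t) {f : ℝ → E} (hf : ContinuousOn f (Icc 0 t)) :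
    rlIntegral b (fun s => L (f s)) t = L (rlIntegral b f t) := by
  rcases hb.eq_or_lt with rfl | hb
  · simp [rlIntegral]
  · simp only [rlIntegral_of_pos hb, map_smul]
    rw [← L.intervalIntegral_comp_comm (intervalIntegrable_sub_rpow_smul hb ht hf)]
    simp

theorem rlIntegral_rpow_smul [CompleteSpace E] {b q t : ℝ} (hb : 0 ≤ b) (hq : 0 ≤ q)
    (ht : 0 ≤ t) (c : E) :
    rlIntegral b (fun s => s ^ q • c) t =
      (Real.Gamma (q + 1) / Real.Gamma (q + b + 1) * t ^ (q + b)) • c := by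
  have hG : Real.Gamma (q + 1) ≠ 0 := (Real.Gamma_pos_of_pos (by linarith)).ne'
  rcases hb.eq_or_lt with rfl | hb
  · simp [rlIntegral, hG]
  rcases ht.eq_or_lt with rfl | ht
  · rw [rlIntegral_at_zero hb, Real.zero_rpow (by linarith)]; simp
  · have h := integral_sub_rpow_mul_rpow (a := b) (b := q + 1) hb (by linarith) ht
    rw [rlIntegral_of_pos hb]
    simp only [smul_smul]
    rw [intervalIntegral.integral_smul_const, smul_smul]
    congr 1
    simp only [add_sub_cancel_right] at h
    have hG' : Real.Gamma b ≠ 0 := (Real.Gamma_pos_of_pos hb).ne'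
    rw [h, show b + (q + 1) = q + b + 1 by ring, add_sub_cancel_right]
    field_simp

theorem rlIntegral_const [CompleteSpace E] {b t : ℝ} (hb : 0 ≤ b) (ht : 0 ≤ t) (c : E) :
    rlIntegral b (fun _ => c) t = (t ^ b / Real.Gamma (b + 1)) • c := by
  have h := rlIntegral_rpow_smul hb le_rfl ht c
  simp only [Real.rpow_zero, one_smul, zero_add, Real.Gamma_one] at h
  rw [h]; congr 1; ring

theorem norm_rlIntegral_le {b t M : ℝ} (hb : 0 ≤ b) (ht : 0 ≤ t) {f : ℝ → E}
    (hM : ∀ s ∈ Icc 0 t, ‖f s‖ ≤ M) :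
    ‖rlIntegral b f t‖ ≤ M * (t ^ b / Real.Gamma (b + 1)) := by
  rcases hb.eq_or_lt with rfl | hb
  · simpa [rlIntegral] using hM t ⟨ht, le_rfl⟩
  have h := rlIntegral_const hb.le ht M
  rw [smul_eq_mul, mul_comm] at h
  rw [← h, rlIntegral_of_pos hb, rlIntegral_of_pos hb, norm_smul, smul_eq_mul, norm_inv,
    Real.norm_of_nonneg (Real.Gamma_pos_of_pos hb).le]
  gcongr
  apply intervalIntegral.norm_integral_le_of_norm_le ht
  · filter_upwards with s hs
    have : 0 ≤ (t - s) ^ (b - 1) := Real.rpow_nonneg (by linarith [hs.2]) _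
    rw [norm_smul, smul_eq_mul, Real.norm_of_nonneg this]
    gcongr
    exact hM s ⟨hs.1.le, hs.2⟩
  · exact intervalIntegrable_sub_rpow_smul hb ht continuousOn_const

/-- Rescaling the integration to `[0, 1]` makes the singularity of the kernel independent of `t`,
so that continuity in `t` follows by dominated convergence. -/
theorem rlIntegral_eq_rescaled {b t : ℝ} (hb : 0 < b) (ht : 0 ≤ t) (f : ℝ → E) :
    rlIntegral b f t =
      (t ^ b / Real.Gamma b) • ∫ σ in (0 : ℝ)..1, (1 - σ) ^ (b - 1) • f (t * σ) := by
  rcases ht.eq_or_lt with rfl | ht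
  · rw [rlIntegral_at_zero hb, Real.zero_rpow hb.ne']; simp
  rw [rlIntegral_of_pos hb]
  have h := intervalIntegral.integral_comp_mul_left (a := 0) (b := 1)
    (fun s => (t - s) ^ (b - 1) • f s) ht.ne'
  simp only [mul_zero, mul_one] at h
  have h2 : ∫ s in (0 : ℝ)..t, (t - s) ^ (b - 1) • f s =
      t • ∫ σ in (0 : ℝ)..1, (t - t * σ) ^ (b - 1) • f (t * σ) := by
    rw [h, smul_smul, mul_inv_cancel₀ ht.ne', one_smul]
  have h3 : ∫ σ in (0 : ℝ)..1, (t - t * σ) ^ (b - 1) • f (t * σ) =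
      t ^ (b - 1) • ∫ σ in (0 : ℝ)..1, (1 - σ) ^ (b - 1) • f (t * σ) := by
    rw [← intervalIntegral.integral_smul]
    apply intervalIntegral.integral_congr
    intro σ hσ
    rw [uIcc_of_le zero_le_one] at hσ
    simp only
    rw [smul_smul, ← Real.mul_rpow ht.le (by linarith [hσ.2])]
    congr 2; ring
  rw [h2, h3, smul_smul, smul_smul]
  congr 1
  rw [Real.rpow_sub_one ht.ne']
  field_simp

theorem continuousOn_rlIntegral {b T : ℝ} (hb : 0 ≤ b) {f : ℝ → E}
    (hf : ContinuousOn f (Icc 0 T)) : ContinuousOn (rlIntegral b f) (Icc 0 T) := by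
  rcases hb.eq_or_lt with rfl | hb
  · rwa [rlIntegral_zero_order]
  rcases lt_or_ge T 0 with hT | hT
  · rw [Icc_eq_empty (by linarith)]; exact continuousOn_empty _
  have hsub : ∀ t ∈ Icc 0 T, ∀ σ ∈ Icc (0 : ℝ) 1, t * σ ∈ Icc 0 T := fun t ht σ hσ =>
    ⟨mul_nonneg ht.1 hσ.1, (mul_le_of_le_one_right ht.1 hσ.2).trans ht.2⟩
  obtain ⟨M, hM⟩ := isCompact_Icc.exists_bound_of_continuousOn hf
  have key : ContinuousOn
      (fun t => ∫ σ in (0 : ℝ)..1, (1 - σ) ^ (b - 1) • f (t * σ)) (Icc 0 T) := by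
    intro t₀ ht₀
    apply intervalIntegral.continuousWithinAt_of_dominated_interval
      (bound := fun σ => (1 - σ) ^ (b - 1) * M)
    · filter_upwards [self_mem_nhdsWithin] with t ht
      rw [uIoc_of_le zero_le_one]
      apply Integrable.aestronglyMeasurable
      refine (intervalIntegrable_sub_rpow_smul (f := fun σ => f (t * σ)) hb zero_le_one ?_).1
      exact hf.comp (by fun_prop) (fun σ hσ => hsub t ht σ hσ)
    · filter_upwards [self_mem_nhdsWithin] with t ht
      filter_upwards with σ hσ
      rw [uIoc_of_le zero_le_one] at hσ
      have : 0 ≤ (1 - σ) ^ (b - 1) := Real.rpow_nonneg (by linarith [hσ.2]) _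
      rw [norm_smul, Real.norm_of_nonneg this]
      gcongr
      exact hM _ (hsub t ht σ ⟨hσ.1.le, hσ.2⟩)
    · exact intervalIntegrable_sub_rpow_smul (f := fun _ => M) hb zero_le_one continuousOn_const
    · filter_upwards with σ hσ
      rw [uIoc_of_le zero_le_one] at hσ
      apply ContinuousWithinAt.const_smul
      exact (hf.comp (f := fun t => t * σ) (by fun_prop)
        (fun t ht => hsub t ht σ ⟨hσ.1.le, hσ.2⟩)) t₀ ht₀
  have h2 : ContinuousOn (fun t : ℝ => (t ^ b / Real.Gamma b)) (Icc 0 T) :=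
    ((Real.continuous_rpow_const hb.le).div_const _).continuousOn
  exact (h2.smul key).congr fun t ht => rlIntegral_eq_rescaled hb ht.1 f

end RiemannLiouville

/-! ### The semigroup law -/

section Semigroup

variable {E : Type*} [NormedAddCommGroup E] [NormedSpace ℝ E]

theorem setIntegral_indicator_sub_rpow_smul {b s t : ℝ} (f : ℝ → E) (hs : s ∈ Icc 0 t) :
    ∫ r in Ioc 0 t, (Ioi (0 : ℝ)).indicator (fun x => x ^ (b - 1)) (s - r) • f r =
      ∫ r in (0 : ℝ)..s, (s - r) ^ (b - 1) • f r := by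
  have h : ∀ r, (Ioi (0 : ℝ)).indicator (fun x => x ^ (b - 1)) (s - r) • f r =
      (Iio s).indicator (fun r => (s - r) ^ (b - 1) • f r) r := by
    intro r
    by_cases hr : r < s <;> simp [indicator, hr]
  simp only [h]
  rw [setIntegral_indicator measurableSet_Iio, intervalIntegral.integral_of_le hs.1,
    integral_Ioc_eq_integral_Ioo]
  congr 2
  ext r
  simp only [mem_inter_iff, mem_Ioc, mem_Iio, mem_Ioo]
  constructor
  · rintro ⟨⟨h1, _⟩, h2⟩; exact ⟨h1, h2⟩
  · rintro ⟨h1, h2⟩; exact ⟨⟨h1, h2.le.trans hs.2⟩, h2⟩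

theorem setIntegral_sub_rpow_mul_indicator {a b r t : ℝ} (ha : 0 < a) (hb : 0 < b)
    (hr : r ∈ Ioo 0 t) :
    ∫ s in Ioc 0 t, (t - s) ^ (a - 1) * (Ioi (0 : ℝ)).indicator (fun x => x ^ (b - 1)) (s - r) =
      Real.Gamma a * Real.Gamma b / Real.Gamma (a + b) * (t - r) ^ (a + b - 1) := by
  rw [← integral_sub_rpow_mul_rpow ha hb (sub_pos.2 hr.2)]
  have h : ∀ s, (t - s) ^ (a - 1) * (Ioi (0 : ℝ)).indicator (fun x => x ^ (b - 1)) (s - r) =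
      (Ioi r).indicator (fun s => (t - s) ^ (a - 1) * (s - r) ^ (b - 1)) s := by
    intro s
    by_cases hs : r < s <;> simp [indicator, hs]
  simp only [h]
  rw [setIntegral_indicator measurableSet_Ioi]
  have h2 : Ioc 0 t ∩ Ioi r = Ioc r t := by
    ext s
    simp only [mem_inter_iff, mem_Ioc, mem_Ioi]
    constructor
    · rintro ⟨⟨_, h1⟩, h2⟩; exact ⟨h2, h1⟩
    · rintro ⟨h1, h2⟩; exact ⟨⟨hr.1.trans h1, h2⟩, h1⟩
  rw [h2, ← intervalIntegral.integral_of_le hr.2.le]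
  have h3 := intervalIntegral.integral_comp_sub_right (a := r) (b := t)
    (fun s => (t - r - s) ^ (a - 1) * s ^ (b - 1)) r
  simp only [sub_self] at h3
  rw [← h3]
  congr 1
  ext s
  congr 2; ring

theorem integrable_prod_sub_rpow {a b t : ℝ} (ha : 0 < a) (hb : 0 < b) (ht : 0 ≤ t) :
    Integrable (fun p : ℝ × ℝ => (t - p.1) ^ (a - 1) *
      (Ioi (0 : ℝ)).indicator (fun x => x ^ (b - 1)) (p.1 - p.2))
      ((volume.restrict (Ioc 0 t)).prod (volume.restrict (Ioc 0 t))) := by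
  have hmeas : Measurable (fun p : ℝ × ℝ => (t - p.1) ^ (a - 1) *
      (Ioi (0 : ℝ)).indicator (fun x => x ^ (b - 1)) (p.1 - p.2)) := by
    have h1 : Measurable ((Ioi (0 : ℝ)).indicator (fun x : ℝ => x ^ (b - 1))) :=
      Measurable.indicator (by fun_prop) measurableSet_Ioi
    exact Measurable.mul (by fun_prop) (h1.comp (by fun_prop))
  have hind : ∀ x : ℝ, 0 ≤ (Ioi (0 : ℝ)).indicator (fun x => x ^ (b - 1)) x := fun x =>
    indicator_nonneg (fun y hy => Real.rpow_nonneg (le_of_lt hy) _) x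
  rw [integrable_prod_iff hmeas.aestronglyMeasurable]
  constructor
  · filter_upwards [ae_restrict_mem measurableSet_Ioc] with s hs
    apply Integrable.const_mul
    have h : ∀ r, (Ioi (0 : ℝ)).indicator (fun x => x ^ (b - 1)) (s - r) =
        (Iio s).indicator (fun r => (s - r) ^ (b - 1)) r := by
      intro r
      by_cases hr : r < s <;> simp [indicator, hr]
    simp only [h]
    rw [integrable_indicator_iff measurableSet_Iio, IntegrableOn,
      Measure.restrict_restrict measurableSet_Iio]
    have h2 := (intervalIntegrable_sub_rpow hb s).1
    refine IntegrableOn.mono_set h2 ?_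
    rintro r ⟨h1, h2⟩
    exact ⟨h2.1, le_of_lt h1⟩
  · have h2 := (intervalIntegrable_sub_rpow_smul ha (f := fun s : ℝ => s ^ b / b) ht
      ((Real.continuous_rpow_const hb.le).div_const _).continuousOn).1
    refine Integrable.congr h2 ?_
    filter_upwards [ae_restrict_mem measurableSet_Ioc] with s hs
    have hn : 0 ≤ (t - s) ^ (a - 1) := Real.rpow_nonneg (by linarith [hs.2]) _
    have h3 := setIntegral_indicator_sub_rpow_smul (b := b) (fun _ => (1 : ℝ))
      ⟨hs.1.le, hs.2⟩
    have h4 := integral_sub_rpow_mul_rpow hb one_pos hs.1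
    simp only [sub_self, Real.rpow_zero, Real.Gamma_one, Real.Gamma_add_one hb.ne',
      mul_one, add_sub_cancel_right] at h4
    have h5 : ∀ r, ‖(t - s) ^ (a - 1) * (Ioi (0 : ℝ)).indicator (fun x => x ^ (b - 1)) (s - r)‖ =
        (t - s) ^ (a - 1) * (Ioi (0 : ℝ)).indicator (fun x => x ^ (b - 1)) (s - r) := fun r =>
      Real.norm_of_nonneg (mul_nonneg hn (hind _))
    simp only [h5, smul_eq_mul, mul_one] at h3 ⊢
    rw [integral_const_mul, h3, h4]
    have := (Real.Gamma_pos_of_pos hb).ne'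
    field_simp

/-- The semigroup law of fractional integration, by Fubini's theorem on the triangle
`0 < r < s < t` and Euler's beta integral. -/
theorem rlIntegral_rlIntegral [CompleteSpace E] {a b T : ℝ} (ha : 0 ≤ a) (hb : 0 ≤ b) {f : ℝ → E}
    (hf : ContinuousOn f (Icc 0 T)) :
    EqOn (rlIntegral a (rlIntegral b f)) (rlIntegral (a + b) f) (Icc 0 T) := by
  intro t ht
  rcases ha.eq_or_lt with rfl | ha
  · rw [rlIntegral_zero_order, zero_add]
  rcases hb.eq_or_lt with rfl | hb
  · rw [rlIntegral_zero_order, add_zero]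
  have hft : ContinuousOn f (Icc 0 t) := hf.mono (Icc_subset_Icc_right ht.2)
  have hGa : Real.Gamma a ≠ 0 := (Real.Gamma_pos_of_pos ha).ne'
  have hGb : Real.Gamma b ≠ 0 := (Real.Gamma_pos_of_pos hb).ne'
  obtain ⟨M, hM⟩ := isCompact_Icc.exists_bound_of_continuousOn hft
  have hint : Integrable (fun p : ℝ × ℝ => ((t - p.1) ^ (a - 1) *
      (Ioi (0 : ℝ)).indicator (fun x => x ^ (b - 1)) (p.1 - p.2)) • f p.2)
      ((volume.restrict (Ioc 0 t)).prod (volume.restrict (Ioc 0 t))) := by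
    have h := integrable_prod_sub_rpow ha hb ht.1
    refine h.smul_bdd (C := M) ?_ ?_
    · have h1 : AEStronglyMeasurable f (volume.restrict (Ioc 0 t)) :=
        (hft.mono Ioc_subset_Icc_self).aestronglyMeasurable measurableSet_Ioc
      exact h1.comp_snd
    · rw [Measure.prod_restrict]
      filter_upwards [ae_restrict_mem (measurableSet_Ioc.prod measurableSet_Ioc)] with p hp
      exact hM _ ⟨hp.2.1.le, hp.2.2⟩
  have hswap := integral_integral_swap (f := fun s r => ((t - s) ^ (a - 1) *
      (Ioi (0 : ℝ)).indicator (fun x => x ^ (b - 1)) (s - r)) • f r) hint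
  have hL : ∫ s in Ioc 0 t, ∫ r in Ioc 0 t, ((t - s) ^ (a - 1) *
      (Ioi (0 : ℝ)).indicator (fun x => x ^ (b - 1)) (s - r)) • f r =
      Real.Gamma b • ∫ s in (0 : ℝ)..t, (t - s) ^ (a - 1) • rlIntegral b f s := by
    rw [← intervalIntegral.integral_smul, intervalIntegral.integral_of_le ht.1]
    apply setIntegral_congr_fun measurableSet_Ioc
    intro s hs
    simp only [mul_smul, integral_smul]
    rw [setIntegral_indicator_sub_rpow_smul f ⟨hs.1.le, hs.2⟩, rlIntegral_of_pos hb,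
      smul_comm (Real.Gamma b), smul_smul (Real.Gamma b), mul_inv_cancel₀ hGb, one_smul]
  have hR : ∫ r in Ioc 0 t, ∫ s in Ioc 0 t, ((t - s) ^ (a - 1) *
      (Ioi (0 : ℝ)).indicator (fun x => x ^ (b - 1)) (s - r)) • f r =
      (Real.Gamma a * Real.Gamma b / Real.Gamma (a + b)) •
        ∫ r in (0 : ℝ)..t, (t - r) ^ (a + b - 1) • f r := by
    rw [← intervalIntegral.integral_smul, intervalIntegral.integral_of_le ht.1,
      integral_Ioc_eq_integral_Ioo, integral_Ioc_eq_integral_Ioo]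
    apply setIntegral_congr_fun measurableSet_Ioo
    intro r hr
    simp only
    rw [integral_smul_const, setIntegral_sub_rpow_mul_indicator ha hb hr, mul_smul]
  rw [hL, hR] at hswap
  rw [rlIntegral_of_pos ha, rlIntegral_of_pos (add_pos ha hb)]
  have h6 := congrArg (fun v => ((Real.Gamma a)⁻¹ * (Real.Gamma b)⁻¹) • v) hswap
  simp only [smul_smul] at h6
  convert h6 using 2 <;> field_simp

end Semigroup

/-! ### Derivatives of fractional integrals and the Volterra equation -/

section Derivatives

variable {E : Type*} [NormedAddCommGroup E] [NormedSpace ℝ E]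

theorem hasDerivWithinAt_integral {T t : ℝ} [CompleteSpace E] {g : ℝ → E}
    (hg : ContinuousOn g (Icc 0 T)) (ht : t ∈ Icc 0 T) :
    HasDerivWithinAt (fun t => ∫ s in (0 : ℝ)..t, g s) (g t) (Icc 0 T) t := by
  have : Fact (t ∈ Icc 0 T) := ⟨ht⟩
  apply intervalIntegral.integral_hasDerivWithinAt_right
  · apply ContinuousOn.intervalIntegrable
    rw [uIcc_of_le ht.1]
    exact hg.mono (Icc_subset_Icc_right ht.2)
  · exact hg.stronglyMeasurableAtFilter_nhdsWithin measurableSet_Icc t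
  · exact hg t ht

theorem hasDerivWithinAt_rlIntegral {b T t : ℝ} [CompleteSpace E] (hb : 0 ≤ b) {f : ℝ → E}
    (hf : ContinuousOn f (Icc 0 T)) (ht : t ∈ Icc 0 T) :
    HasDerivWithinAt (rlIntegral (b + 1) f) (rlIntegral b f t) (Icc 0 T) t := by
  have h1 : EqOn (rlIntegral (b + 1) f) (fun t => ∫ s in (0 : ℝ)..t, rlIntegral b f s)
      (Icc 0 T) := by
    intro s hs
    rw [add_comm, ← rlIntegral_rlIntegral zero_le_one hb hf hs, rlIntegral_one]
  exact (hasDerivWithinAt_integral (continuousOn_rlIntegral hb hf) ht).congr h1 (h1 ht)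

/-- A finite chain of successive one-sided derivatives consists of the iterated derivatives of its
first member. -/
theorem iteratedDerivWithin_of_chain {T : ℝ} (hT : 0 < T) {N : ℕ} {F : ℕ → ℝ → E}
    (h : ∀ i < N, ∀ t ∈ Icc 0 T, HasDerivWithinAt (F i) (F (i + 1) t) (Icc 0 T) t) {i : ℕ}
    (hi : i ≤ N) : EqOn (iteratedDerivWithin i (F 0) (Icc 0 T)) (F i) (Icc 0 T) := by
  induction i with
  | zero => intro t _; simp
  | succ i ih =>
    intro t ht
    have h1 := ih (by omega)
    rw [iteratedDerivWithin_succ, derivWithin_congr h1 (h1 ht)]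
    exact (h i (by omega) t ht).derivWithin (uniqueDiffOn_Icc hT t ht)

theorem contDiffOn_of_chain {T : ℝ} (hT : 0 < T) {N : ℕ} {F : ℕ → ℝ → E}
    (h : ∀ i < N, ∀ t ∈ Icc 0 T, HasDerivWithinAt (F i) (F (i + 1) t) (Icc 0 T) t)
    (hN : ContinuousOn (F N) (Icc 0 T)) :
    ContDiffOn ℝ (N : WithTop ℕ∞) (F 0) (Icc 0 T) := by
  rw [contDiffOn_nat_iff_continuousOn_differentiableOn_deriv (uniqueDiffOn_Icc hT)]
  constructor
  · intro i hi
    refine ContinuousOn.congr ?_ (iteratedDerivWithin_of_chain hT h hi)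
    rcases hi.eq_or_lt with rfl | hi
    · exact hN
    · exact fun t ht => (h i hi t ht).continuousWithinAt
  · intro i hi
    refine DifferentiableOn.congr ?_ (iteratedDerivWithin_of_chain hT h hi.le)
    exact fun t ht => (h i hi t ht).differentiableWithinAt

/-- The successive derivatives of `I ^ (N + b) f` on `[0, T]` are `I ^ (N + b - i) f`. -/
theorem rlIntegral_chain {T b : ℝ} [CompleteSpace E] (hb : 0 ≤ b) {N : ℕ} {f : ℝ → E}
    (hf : ContinuousOn f (Icc 0 T)) :
    ∀ i < N, ∀ t ∈ Icc 0 T, HasDerivWithinAt (rlIntegral ((N - i : ℕ) + b) f)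
      (rlIntegral ((N - (i + 1) : ℕ) + b) f t) (Icc 0 T) t := by
  intro i hi t ht
  have h : ((N - i : ℕ) : ℝ) + b = ((N - (i + 1) : ℕ) + b) + 1 := by
    rw [show N - i = (N - (i + 1)) + 1 by omega]; push_cast; ring
  rw [h]
  exact hasDerivWithinAt_rlIntegral (by positivity) hf ht

theorem contDiffOn_rlIntegral {T b : ℝ} [CompleteSpace E] (hT : 0 < T) (hb : 0 ≤ b) (N : ℕ)
    {f : ℝ → E} (hf : ContinuousOn f (Icc 0 T)) :
    ContDiffOn ℝ (N : WithTop ℕ∞) (rlIntegral (N + b) f) (Icc 0 T) := by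
  have h := contDiffOn_of_chain (F := fun i => rlIntegral ((N - i : ℕ) + b) f) hT
    (rlIntegral_chain hb hf) (by simpa using continuousOn_rlIntegral hb hf)
  simpa using h

theorem iteratedDerivWithin_rlIntegral {T b : ℝ} [CompleteSpace E] (hT : 0 < T) (hb : 0 ≤ b)
    (N : ℕ) {f : ℝ → E} (hf : ContinuousOn f (Icc 0 T)) {i : ℕ} (hi : i ≤ N) :
    EqOn (iteratedDerivWithin i (rlIntegral (N + b) f) (Icc 0 T))
      (rlIntegral ((N - i : ℕ) + b) f) (Icc 0 T) := by
  have h := iteratedDerivWithin_of_chain (F := fun i => rlIntegral ((N - i : ℕ) + b) f) hT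
    (rlIntegral_chain hb hf) hi
  simpa using h

theorem hasDerivAt_taylor_sum (c : ℕ → E) (N : ℕ) (t : ℝ) :
    HasDerivAt (fun t : ℝ => ∑ j ∈ Finset.range (N + 1), (t ^ j / j.factorial) • c j)
      (∑ j ∈ Finset.range N, (t ^ j / j.factorial) • c (j + 1)) t := by
  simp only [Finset.sum_range_succ' _ N]
  have h : HasDerivAt (fun t : ℝ => ∑ j ∈ Finset.range N,
      (t ^ (j + 1) / (j + 1).factorial) • c (j + 1))
      (∑ j ∈ Finset.range N, (t ^ j / j.factorial) • c (j + 1)) t := by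
    apply HasDerivAt.fun_sum
    intro j _
    have h1 := ((hasDerivAt_pow (j + 1) t).div_const ((j + 1).factorial : ℝ)).smul_const (c (j + 1))
    convert h1 using 2
    rw [Nat.factorial_succ]
    push_cast
    rw [mul_div_mul_left _ _ (by positivity)]
  simpa using h.add_const ((t ^ 0 / (Nat.factorial 0 : ℝ)) • c 0)

end Derivatives

section Solutions

variable {E : Type*} [NormedAddCommGroup E] [NormedSpace ℝ E]

/-- The `i`-th derivative, for `i < k`, of `∑ j < k, t ^ j / j! • c j + I ^ α f`. -/
noncomputable def solutionDeriv (k : ℕ) (α : ℝ) (c : ℕ → E) (f : ℝ → E) (i : ℕ) (t : ℝ) : E :=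
  (∑ j ∈ Finset.range (k - i), (t ^ j / j.factorial) • c (j + i)) +
    rlIntegral (α - (i : ℕ)) f t

theorem hasDerivWithinAt_solutionDeriv [CompleteSpace E] {k : ℕ} {α T : ℝ}
    (hα : (k : ℝ) - 1 < α) (c : ℕ → E) {f : ℝ → E}
    (hf : ContinuousOn f (Icc 0 T)) :
    ∀ i < k - 1, ∀ t ∈ Icc 0 T,
      HasDerivWithinAt (solutionDeriv k α c f i) (solutionDeriv k α c f (i + 1) t) (Icc 0 T) t := by
  intro i hi t ht
  have hk : k - i = (k - (i + 1)) + 1 := by omega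
  have hi' : (i : ℝ) + 1 + 1 ≤ k := by exact_mod_cast (by omega : i + 1 + 1 ≤ k)
  apply HasDerivWithinAt.add
  · rw [hk]
    have h := (hasDerivAt_taylor_sum (fun j => c (j + i)) (k - (i + 1)) t).hasDerivWithinAt
      (s := Icc 0 T)
    simpa only [add_assoc, add_comm 1 i] using h
  · have h := hasDerivWithinAt_rlIntegral (b := α - (i + 1 : ℕ)) (by push_cast; linarith) hf ht
    convert h using 2
    push_cast; ring

theorem iteratedDerivWithin_zero_of_eq_add_rlIntegral [CompleteSpace E] {k : ℕ} {α T : ℝ}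
    (hT : 0 < T)
    (hα : (k : ℝ) - 1 < α) {c : ℕ → E} {f x : ℝ → E} (hf : ContinuousOn f (Icc 0 T))
    (hx : ∀ t ∈ Icc 0 T,
      x t = (∑ j ∈ Finset.range k, (t ^ j / j.factorial) • c j) + rlIntegral α f t)
    {j : ℕ} (hj : j < k) : iteratedDerivWithin j x (Icc 0 T) 0 = c j := by
  have h0 : (0 : ℝ) ∈ Icc 0 T := ⟨le_rfl, hT.le⟩
  have hj' : (j : ℝ) + 1 ≤ k := by exact_mod_cast hj
  have h := iteratedDerivWithin_of_chain hT (hasDerivWithinAt_solutionDeriv hα c hf)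
    (N := k - 1) (i := j) (by omega) h0
  have hx' : EqOn x (solutionDeriv k α c f 0) (Icc 0 T) := by
    intro t ht; simpa [solutionDeriv] using hx t ht
  rw [iteratedDerivWithin_congr hx' h0, h, solutionDeriv, rlIntegral_at_zero (by linarith),
    show k - j = (k - (j + 1)) + 1 by omega, Finset.sum_range_succ']
  simp

theorem contDiffOn_of_eq_add_rlIntegral [CompleteSpace E] {k : ℕ} {α T : ℝ}
    (hk : 1 ≤ k) (hT : 0 < T)
    (hα : (k : ℝ) - 1 < α) {c : ℕ → E} {f x : ℝ → E} (hf : ContinuousOn f (Icc 0 T))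
    (hx : ∀ t ∈ Icc 0 T,
      x t = (∑ j ∈ Finset.range k, (t ^ j / j.factorial) • c j) + rlIntegral α f t) :
    ContDiffOn ℝ ((k - 1 : ℕ) : WithTop ℕ∞) x (Icc 0 T) := by
  have h := contDiffOn_of_chain hT (hasDerivWithinAt_solutionDeriv hα c hf) (by
    apply ContinuousOn.add
    · fun_prop
    · apply continuousOn_rlIntegral _ hf
      rw [Nat.cast_sub hk]; push_cast; linarith)
  refine h.congr fun t ht => ?_
  simpa [solutionDeriv] using hx t ht

theorem caputoPrimitive_of_eq_add_rlIntegral [CompleteSpace E] {k : ℕ} {α T : ℝ}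
    (hk : 1 ≤ k) (hT : 0 < T)
    (hα : (k : ℝ) - 1 < α) (hα' : α ≤ k) {c : ℕ → E} {f x : ℝ → E}
    (hf : ContinuousOn f (Icc 0 T))
    (hx : ∀ t ∈ Icc 0 T,
      x t = (∑ j ∈ Finset.range k, (t ^ j / j.factorial) • c j) + rlIntegral α f t) :
    EqOn (caputoPrimitive k α T x) (rlIntegral k f) (Icc 0 T) := by
  have h1 : EqOn (fun s => x s - taylorWithinEval x (k - 1) (Icc 0 T) 0 s) (rlIntegral α f)
      (Icc 0 T) := by
    intro s hs
    simp only
    rw [taylor_within_apply, Nat.sub_add_cancel hk, hx s hs, sub_eq_iff_eq_add', add_left_inj]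
    apply Finset.sum_congr rfl
    intro j hj
    rw [iteratedDerivWithin_zero_of_eq_add_rlIntegral hT hα hf hx (Finset.mem_range.1 hj)]
    congr 1
    rw [sub_zero]; ring
  have hk' : (1 : ℝ) ≤ k := by exact_mod_cast hk
  intro t ht
  unfold caputoPrimitive
  rw [rlIntegral_congr h1 ht, rlIntegral_rlIntegral (by linarith) (by linarith) hf ht]
  congr 2; ring

theorem hasCaputoDerivAt_of_eq_add_rlIntegral [CompleteSpace E] {k : ℕ} {α T : ℝ}
    (hk : 1 ≤ k) (hT : 0 < T)
    (hα : (k : ℝ) - 1 < α) (hα' : α ≤ k) {c : ℕ → E} {f x : ℝ → E}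
    (hf : ContinuousOn f (Icc 0 T))
    (hx : ∀ t ∈ Icc 0 T,
      x t = (∑ j ∈ Finset.range k, (t ^ j / j.factorial) • c j) + rlIntegral α f t)
    {t : ℝ} (ht : t ∈ Ioo 0 T) : HasCaputoDerivAt k α T x (f t) t := by
  have h1 := caputoPrimitive_of_eq_add_rlIntegral hk hT hα hα' hf hx
  have h2 : EqOn (iteratedDerivWithin (k - 1) (caputoPrimitive k α T x) (Icc 0 T))
      (rlIntegral (0 + 1) f) (Icc 0 T) := by
    intro s hs
    have h3 := iteratedDerivWithin_rlIntegral hT zero_le_one (k - 1) hf le_rfl hs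
    rw [iteratedDerivWithin_congr h1 hs]
    rw [Nat.cast_sub hk] at h3
    simpa using h3
  have hn : Icc 0 T ∈ 𝓝 t := Icc_mem_nhds ht.1 ht.2
  have h4 := (hasDerivWithinAt_rlIntegral le_rfl hf (Ioo_subset_Icc_self ht)).hasDerivAt hn
  rw [rlIntegral_zero_order] at h4
  exact h4.congr_of_eventuallyEq (h2.eventuallyEq_of_mem hn)

end Solutions

/-- A continuous solution of the Volterra integral equation of the system is a trajectory. -/
theorem isTrajectory_of_integral_eq {n m k : ℕ} {α T : ℝ} (hk : 1 ≤ k) (hα : (k : ℝ) - 1 < α)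
    (hα' : α ≤ k) (hT : 0 < T) (A : Matrix (Fin n) (Fin n) ℝ) (B : Matrix (Fin n) (Fin m) ℝ)
    {u : ℝ → Fin m → ℝ} {x : ℝ → Fin n → ℝ} (hu : ContinuousOn u (Icc 0 T))
    (hx : ContinuousOn x (Icc 0 T)) {c : ℕ → Fin n → ℝ}
    (h : ∀ t ∈ Icc 0 T, x t = (∑ j ∈ Finset.range k, (t ^ j / j.factorial) • c j) +
      rlIntegral α (fun s => A.mulVec (x s) + B.mulVec (u s)) t) :
    IsTrajectory k α A B T u (fun j => c j) x := by
  have hf : ContinuousOn (fun s => A.mulVec (x s) + B.mulVec (u s)) (Icc 0 T) := by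
    apply ContinuousOn.add
    · exact (LinearMap.continuous_of_finiteDimensional A.mulVecLin).comp_continuousOn hx
    · exact (LinearMap.continuous_of_finiteDimensional B.mulVecLin).comp_continuousOn hu
  constructor
  · exact contDiffOn_of_eq_add_rlIntegral hk hT hα hf h
  · exact fun j => iteratedDerivWithin_zero_of_eq_add_rlIntegral hT hα hf h j.2
  · have h1 := contDiffOn_rlIntegral hT zero_le_one (k - 1) hf
    rw [Nat.cast_sub hk] at h1
    simp only [Nat.cast_one, sub_add_cancel] at h1
    exact h1.congr (caputoPrimitive_of_eq_add_rlIntegral hk hT hα hα' hf h)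
  · exact fun t ht _ => hasCaputoDerivAt_of_eq_add_rlIntegral hk hT hα hα' hf h ht

/-! ### Mittag-Leffler series -/

section GammaBounds

/-- The growth of the Gamma function beyond every exponential: `Γ s ≥ e ^ (-R) R ^ (s - 1)`, by
restricting Euler's integral to `(R, ∞)`. -/
theorem exp_neg_mul_rpow_le_Gamma {R s : ℝ} (hR : 0 < R) (hs : 1 ≤ s) :
    Real.exp (-R) * R ^ (s - 1) ≤ Real.Gamma s := by
  have hs0 : 0 < s := by linarith
  have hint := Real.GammaIntegral_convergent hs0
  rw [Real.Gamma_eq_integral hs0, ← integral_exp_neg_Ioi R, ← integral_mul_const]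
  calc ∫ x in Ioi R, Real.exp (-x) * R ^ (s - 1)
      ≤ ∫ x in Ioi R, Real.exp (-x) * x ^ (s - 1) := by
        apply setIntegral_mono_on _ (hint.mono_set (Ioi_subset_Ioi hR.le)) measurableSet_Ioi
        · intro x hx
          have hx' : R ≤ x := le_of_lt hx
          gcongr
        · exact (integrableOn_exp_neg_Ioi R).mul_const _
    _ ≤ ∫ x in Ioi 0, Real.exp (-x) * x ^ (s - 1) := by
        apply setIntegral_mono_set hint
        · filter_upwards [ae_restrict_mem measurableSet_Ioi] with x hx
          have : (0 : ℝ) < x := hx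
          simp only [Pi.zero_apply]
          positivity
        · exact (Ioi_subset_Ioi hR.le).eventuallyLE

theorem summable_pow_div_Gamma {α γ C : ℝ} (hα : 0 < α) (hC : 0 ≤ C) :
    Summable fun l : ℕ => C ^ l / Real.Gamma (α * l + γ) := by
  -- With `R ^ α = 2 C + 1` the terms are eventually dominated by a geometric series of ratio `< 1`.
  set R : ℝ := (2 * C + 1) ^ (1 / α) with hR
  have hR0 : 0 < R := by positivity
  have hRα : R ^ α = 2 * C + 1 := by
    rw [hR, ← Real.rpow_mul (by positivity), one_div_mul_cancel hα.ne', Real.rpow_one]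
  have hq : C / (2 * C + 1) < 1 := by rw [div_lt_one (by positivity)]; linarith
  have hgeo := (summable_geometric_of_lt_one (by positivity : 0 ≤ C / (2 * C + 1)) hq).mul_left
    (Real.exp R * R ^ (1 - γ))
  apply Summable.of_norm_bounded_eventually_nat hgeo
  have hlim : Tendsto (fun l : ℕ => α * (l : ℝ) + γ) atTop atTop :=
    tendsto_atTop_add_const_right _ _ (tendsto_natCast_atTop_atTop.const_mul_atTop hα)
  filter_upwards [hlim.eventually_ge_atTop 1] with l hl
  have hG := exp_neg_mul_rpow_le_Gamma hR0 hl
  have hpos : 0 < Real.exp (-R) * R ^ (α * l + γ - 1) := by positivity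
  rw [Real.norm_of_nonneg (div_nonneg (by positivity) (hpos.le.trans hG))]
  calc C ^ l / Real.Gamma (α * l + γ) ≤ C ^ l / (Real.exp (-R) * R ^ (α * l + γ - 1)) := by
        gcongr
    _ = Real.exp R * R ^ (1 - γ) * (C / (2 * C + 1)) ^ l := by
        rw [Real.exp_neg, show α * (l : ℝ) + γ - 1 = α * l - (1 - γ) by ring,
          Real.rpow_sub hR0, Real.rpow_mul hR0.le, Real.rpow_natCast, hRα, div_pow]
        field_simp

end GammaBounds

section Series

variable {E F : Type*} [NormedAddCommGroup E] [NormedSpace ℝ E]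
  [NormedAddCommGroup F] [NormedSpace ℝ F]

/-- A sequence growing at most geometrically. -/
def IsGeomBounded (c : ℕ → E) : Prop := ∃ K C : ℝ, 0 ≤ C ∧ ∀ l, ‖c l‖ ≤ K * C ^ l

theorem IsGeomBounded.comp_succ {G : Type*} [NormedAddCommGroup G] {c : ℕ → G}
    (h : IsGeomBounded c) :
    IsGeomBounded fun l => c (l + 1) := by
  obtain ⟨K, C, hC, h⟩ := h
  exact ⟨K * C, C, hC, fun l => (h (l + 1)).trans_eq (by ring)⟩

theorem IsGeomBounded.clm {c : ℕ → E} (h : IsGeomBounded c) (L : E →L[ℝ] F) :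
    IsGeomBounded fun l => L (c l) := by
  obtain ⟨K, C, hC, h⟩ := h
  refine ⟨‖L‖ * K, C, hC, fun l => (L.le_opNorm _).trans ?_⟩
  rw [mul_assoc]
  gcongr
  exact h l

theorem isGeomBounded_pow_mulVec {n : ℕ} (A : Matrix (Fin n) (Fin n) ℝ) (w : Fin n → ℝ) :
    IsGeomBounded fun l => (A ^ l).mulVec w := by
  let L : (Fin n → ℝ) →L[ℝ] (Fin n → ℝ) := LinearMap.toContinuousLinearMap A.mulVecLin
  refine ⟨‖w‖, ‖L‖, norm_nonneg _, fun l => ?_⟩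
  induction l with
  | zero => simp
  | succ l ih =>
    have h : (A ^ (l + 1)).mulVec w = L ((A ^ l).mulVec w) := by
      simp [L, pow_succ', Matrix.mulVec_mulVec]
    simp only at ih ⊢
    rw [h, pow_succ]
    calc _ ≤ ‖L‖ * ‖(A ^ l).mulVec w‖ := L.le_opNorm _
      _ ≤ ‖L‖ * (‖w‖ * ‖L‖ ^ l) := by gcongr
      _ = _ := by ring

/-- The generalized Mittag-Leffler series `∑ l, t ^ (α l + β) / Γ(α l + γ) • c l`. -/
noncomputable def mittagLeffler (α β γ : ℝ) (c : ℕ → E) (t : ℝ) : E :=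
  ∑' l : ℕ, (t ^ (α * (l : ℝ) + β) / Real.Gamma (α * (l : ℝ) + γ)) • c l

theorem rpow_mul_natCast_add {α β t : ℝ} (hα : 0 < α) (hβ : 0 ≤ β) (ht : 0 ≤ t) (l : ℕ) :
    t ^ (α * (l : ℝ) + β) = (t ^ α) ^ l * t ^ β := by
  rw [Real.rpow_add_of_nonneg ht (by positivity) hβ, Real.rpow_mul_natCast ht]

/-- On `[0, T]` the Mittag-Leffler series is dominated by a convergent numerical series. -/
theorem exists_summable_bound {α β γ T : ℝ} (hα : 0 < α) (hβ : 0 ≤ β) (hγ : 0 < γ) (hT : 0 ≤ T)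
    {c : ℕ → E} (hc : IsGeomBounded c) :
    ∃ b : ℕ → ℝ, Summable b ∧ ∀ l : ℕ, ∀ t ∈ Icc 0 T,
      ‖(t ^ (α * (l : ℝ) + β) / Real.Gamma (α * (l : ℝ) + γ)) • c l‖ ≤ b l := by
  obtain ⟨K, C, hC, h⟩ := hc
  have hC' : 0 ≤ T ^ α * C := by positivity
  refine ⟨fun l => T ^ β * K * ((T ^ α * C) ^ l / Real.Gamma (α * l + γ)),
    (summable_pow_div_Gamma hα hC').mul_left _, fun l t ht => ?_⟩
  have hG : 0 < Real.Gamma (α * l + γ) := Real.Gamma_pos_of_pos (by positivity)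
  have ht0 := ht.1
  have htT := ht.2
  rw [norm_smul, Real.norm_of_nonneg (by positivity), rpow_mul_natCast_add hα hβ ht0]
  calc (t ^ α) ^ l * t ^ β / Real.Gamma (α * l + γ) * ‖c l‖
      ≤ (T ^ α) ^ l * T ^ β / Real.Gamma (α * l + γ) * (K * C ^ l) := by
        gcongr
        exact h l
    _ = T ^ β * K * ((T ^ α * C) ^ l / Real.Gamma (α * l + γ)) := by rw [mul_pow]; ring

theorem summable_mittagLeffler [CompleteSpace E] {α β γ t : ℝ} (hα : 0 < α) (hβ : 0 ≤ β)
    (hγ : 0 < γ) (ht : 0 ≤ t) {c : ℕ → E} (hc : IsGeomBounded c) :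
    Summable fun l : ℕ => (t ^ (α * (l : ℝ) + β) / Real.Gamma (α * (l : ℝ) + γ)) • c l := by
  obtain ⟨b, hb, h⟩ := exists_summable_bound hα hβ hγ ht hc
  exact Summable.of_norm_bounded hb fun l => h l t ⟨ht, le_rfl⟩

theorem continuousOn_mittagLeffler_term {α β γ : ℝ} (hα : 0 < α) (hβ : 0 ≤ β) (c : ℕ → E)
    (l : ℕ) (s : Set ℝ) : ContinuousOn
      (fun t : ℝ => (t ^ (α * (l : ℝ) + β) / Real.Gamma (α * (l : ℝ) + γ)) • c l) s :=
  (((Real.continuous_rpow_const (by positivity)).div_const _).smul continuous_const).continuousOn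

theorem continuousOn_mittagLeffler [CompleteSpace E] {α β γ T : ℝ} (hα : 0 < α) (hβ : 0 ≤ β)
    (hγ : 0 < γ) {c : ℕ → E} (hc : IsGeomBounded c) :
    ContinuousOn (mittagLeffler α β γ c) (Icc 0 T) := by
  rcases lt_or_ge T 0 with hT | hT
  · rw [Icc_eq_empty (by linarith)]; exact continuousOn_empty _
  obtain ⟨b, hb, h⟩ := exists_summable_bound hα hβ hγ hT hc
  exact continuousOn_tsum (fun l => continuousOn_mittagLeffler_term hα hβ c l _) hb h

theorem clm_mittagLeffler [CompleteSpace E] (L : E →L[ℝ] F) {α β γ t : ℝ} (hα : 0 < α)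
    (hβ : 0 ≤ β) (hγ : 0 < γ) (ht : 0 ≤ t) {c : ℕ → E} (hc : IsGeomBounded c) :
    L (mittagLeffler α β γ c t) = mittagLeffler α β γ (fun l => L (c l)) t := by
  unfold mittagLeffler
  rw [L.map_tsum (summable_mittagLeffler hα hβ hγ ht hc)]
  simp only [map_smul]

theorem mittagLeffler_eq_add [CompleteSpace E] {α β t : ℝ} (hα : 0 < α)
    (hβ : 0 ≤ β) (ht : 0 ≤ t) {c : ℕ → E} (hc : IsGeomBounded c) :
    mittagLeffler α β (β + 1) c t = (t ^ β / Real.Gamma (β + 1)) • c 0 +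
      mittagLeffler α (β + α) (β + α + 1) (fun l => c (l + 1)) t := by
  unfold mittagLeffler
  rw [(summable_mittagLeffler hα hβ (by linarith) ht hc).tsum_eq_zero_add]
  simp only [Nat.cast_zero, mul_zero, zero_add, Nat.cast_succ]
  congr 2
  ext l
  rw [show α * ((l : ℝ) + 1) + β = α * l + (β + α) by ring,
    show α * ((l : ℝ) + 1) + (β + 1) = α * l + (β + α + 1) by ring]

theorem rlIntegral_mittagLeffler [CompleteSpace E] {α β t : ℝ} (hα : 0 < α)
    (hβ : 0 ≤ β) (ht : 0 ≤ t) {c : ℕ → E} (hc : IsGeomBounded c) :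
    rlIntegral α (mittagLeffler α β (β + 1) c) t = mittagLeffler α (β + α) (β + α + 1) c t := by
  obtain ⟨b, hb, h⟩ := exists_summable_bound hα hβ (by linarith : 0 < β + 1) ht hc
  have hsum : HasSum (fun l : ℕ => ∫ s in (0 : ℝ)..t, (t - s) ^ (α - 1) •
        (s ^ (α * (l : ℝ) + β) / Real.Gamma (α * (l : ℝ) + (β + 1))) • c l)
      (∫ s in (0 : ℝ)..t, (t - s) ^ (α - 1) • mittagLeffler α β (β + 1) c s) := by
    apply intervalIntegral.hasSum_integral_of_dominated_convergence
      (fun l s => (t - s) ^ (α - 1) * b l)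
    · intro l
      rw [uIoc_of_le ht]
      exact (intervalIntegrable_sub_rpow_smul hα ht
        (continuousOn_mittagLeffler_term hα hβ c l _)).1.aestronglyMeasurable
    · intro l
      filter_upwards with s hs
      rw [uIoc_of_le ht] at hs
      have : 0 ≤ (t - s) ^ (α - 1) := Real.rpow_nonneg (by linarith [hs.2]) _
      rw [norm_smul, Real.norm_of_nonneg this]
      gcongr
      exact h l s ⟨hs.1.le, hs.2⟩
    · filter_upwards with s _
      exact hb.mul_left _
    · simp only [tsum_mul_left]
      exact (intervalIntegrable_sub_rpow hα t).mul_const _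
    · filter_upwards with s hs
      rw [uIoc_of_le ht] at hs
      exact (summable_mittagLeffler hα hβ (by linarith) hs.1.le hc).hasSum.const_smul _
  rw [rlIntegral_of_pos hα, ← hsum.tsum_eq, ← tsum_const_smul'']
  unfold mittagLeffler
  congr 1
  ext l
  rw [← rlIntegral_of_pos hα]
  have hq : 0 ≤ α * (l : ℝ) + β := by positivity
  have h1 := rlIntegral_rpow_smul hα.le hq ht
    ((Real.Gamma (α * (l : ℝ) + (β + 1)))⁻¹ • c l)
  have hG : Real.Gamma (α * (l : ℝ) + β + 1) ≠ 0 := (Real.Gamma_pos_of_pos (by linarith)).ne'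
  simp only [smul_smul, ← add_assoc, div_eq_mul_inv] at h1 ⊢
  rw [h1]
  congr 1
  field_simp

/-- The Mittag-Leffler series with coefficients `A ^ l w` solves
`x = t ^ β / Γ(β + 1) w + I ^ α (A x)`. -/
theorem mittagLeffler_pow_mulVec_eq {n : ℕ} (A : Matrix (Fin n) (Fin n) ℝ) (w : Fin n → ℝ)
    {α β t : ℝ} (hα : 0 < α) (hβ : 0 ≤ β) (ht : 0 ≤ t) :
    mittagLeffler α β (β + 1) (fun l => (A ^ l).mulVec w) t =
      (t ^ β / Real.Gamma (β + 1)) • w +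
        rlIntegral α (fun s =>
          A.mulVec (mittagLeffler α β (β + 1) (fun l => (A ^ l).mulVec w) s)) t := by
  have hc := isGeomBounded_pow_mulVec A w
  let L : (Fin n → ℝ) →L[ℝ] (Fin n → ℝ) := LinearMap.toContinuousLinearMap A.mulVecLin
  have h1 : EqOn (fun s => A.mulVec (mittagLeffler α β (β + 1) (fun l => (A ^ l).mulVec w) s))
      (mittagLeffler α β (β + 1) (fun l => (A ^ (l + 1)).mulVec w)) (Icc 0 t) := by
    intro s hs
    have h2 := clm_mittagLeffler L hα hβ (by linarith : 0 < β + 1) hs.1 hc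
    simpa [L, pow_succ', Matrix.mulVec_mulVec] using h2
  rw [rlIntegral_congr h1 ⟨ht, le_rfl⟩, rlIntegral_mittagLeffler hα hβ ht hc.comp_succ,
    mittagLeffler_eq_add hα hβ ht hc]
  simp

end Series

/-! ### Asymptotic scales and uniqueness of coefficients -/

section AsymptoticScale

/-- Uniqueness of coefficients in a generalized power series: if the functions `ω l` form an
asymptotic scale, each negligible against its predecessors with decreasing quotients, then a series
`∑ l, c l * ω l` that vanishes identically has zero coefficients. Dividing by the first `ω l₀` with
`c l₀ ≠ 0` and passing to the limit under the sum gives `c l₀ = 0`. -/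
theorem eq_zero_of_asymptotic_scale {c : ℕ → ℝ} {ω : ℕ → ℕ → ℝ} (hpos : ∀ l p, 0 < ω l p)
    (hle : ∀ l₀ l p, l₀ ≤ l → ω l p / ω l₀ p ≤ ω l 0 / ω l₀ 0)
    (hlim : ∀ l₀ l, l₀ < l → Tendsto (fun p => ω l p / ω l₀ p) atTop (𝓝 0))
    (hs : Summable fun l => c l * ω l 0) (h0 : ∀ p, ∑' l, c l * ω l p = 0) (l : ℕ) :
    c l = 0 := by
  induction l using Nat.strong_induction_on with
  | _ l₀ ih =>
    have hb : Summable fun l => |c l * ω l 0| / ω l₀ 0 := hs.abs.div_const _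
    have hlim' : ∀ l, Tendsto (fun p => c l * (ω l p / ω l₀ p)) atTop
        (𝓝 (if l = l₀ then c l₀ else 0)) := by
      intro l
      rcases lt_trichotomy l l₀ with h | rfl | h
      · simp [ih l h, h.ne]
      · simp [(hpos l _).ne']
      · simpa [h.ne'] using (hlim l₀ l h).const_mul (c l)
    have h := tendsto_tsum_of_dominated_convergence hb hlim' (by
      filter_upwards with p l
      rcases lt_or_ge l l₀ with h | h
      · simp [ih l h]
      · rw [Real.norm_eq_abs, abs_mul, abs_mul, mul_div_assoc, abs_of_pos (hpos l 0),
          abs_of_pos (div_pos (hpos l p) (hpos l₀ p))]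
        exact mul_le_mul_of_nonneg_left (hle l₀ l p h) (abs_nonneg _))
    have h1 : ∀ p, ∑' l, c l * (ω l p / ω l₀ p) = 0 := by
      intro p
      simp only [← mul_div_assoc]
      rw [tsum_div_const, h0, zero_div]
    simp only [h1, tsum_ite_eq] at h
    exact (tendsto_nhds_unique h tendsto_const_nhds)

theorem eq_zero_of_mittagLeffler_eq_zero {α T : ℝ} (hα : 0 < α) (hT : 0 < T) {c : ℕ → ℝ}
    (hc : IsGeomBounded c) (h : ∀ t ∈ Icc 0 T, mittagLeffler α 0 α c t = 0) (l : ℕ) : c l = 0 := by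
  set s : ℕ → ℝ := fun p => (T / ((p : ℝ) + 1)) ^ α with hs
  have hspos : ∀ p, 0 < s p := fun p => by simp only [hs]; positivity
  have hsle : ∀ p, s p ≤ s 0 := fun p => by
    simp only [hs]
    gcongr
    simp
  have hslim : Tendsto s atTop (𝓝 0) := by
    have h1 : Tendsto (fun p : ℕ => T / ((p : ℝ) + 1)) atTop (𝓝 0) :=
      (tendsto_atTop_add_const_right _ 1 tendsto_natCast_atTop_atTop).const_div_atTop T
    simpa [hs, Real.zero_rpow hα.ne'] using h1.rpow_const (Or.inr hα.le)
  have hG : ∀ l : ℕ, 0 < Real.Gamma (α * l + α) := fun l => Real.Gamma_pos_of_pos (by positivity)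
  have hterm : ∀ l p : ℕ, ((T / ((p : ℝ) + 1)) ^ (α * (l : ℝ) + 0) / Real.Gamma (α * l + α)) • c l =
      c l * (s p ^ l / Real.Gamma (α * l + α)) := by
    intro l p
    rw [add_zero, Real.rpow_mul_natCast (by positivity), smul_eq_mul, mul_comm]
  have hquot : ∀ l₀ l p : ℕ, l₀ ≤ l → (s p ^ l / Real.Gamma (α * l + α)) /
      (s p ^ l₀ / Real.Gamma (α * l₀ + α)) =
      s p ^ (l - l₀) * (Real.Gamma (α * l₀ + α) / Real.Gamma (α * l + α)) := by
    intro l₀ l p hl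
    obtain ⟨d, rfl⟩ := Nat.exists_eq_add_of_le hl
    have := (hspos p).ne'
    have := (hG l₀).ne'
    have := (hG (l₀ + d)).ne'
    rw [add_tsub_cancel_left, pow_add]
    field_simp
  refine eq_zero_of_asymptotic_scale (ω := fun l p => s p ^ l / Real.Gamma (α * l + α))
    (fun l p => div_pos (pow_pos (hspos p) _) (hG l)) ?_ ?_ ?_ ?_ l
  · intro l₀ l p hl
    rw [hquot l₀ l p hl, hquot l₀ l 0 hl]
    have := (hspos p).le
    have := hsle p
    have := hG l
    have := hG l₀
    gcongr
  · intro l₀ l hl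
    simp only [hquot l₀ l _ hl.le]
    have h1 := (hslim.pow (l - l₀)).mul_const (Real.Gamma (α * l₀ + α) / Real.Gamma (α * l + α))
    rwa [zero_pow (by omega), zero_mul] at h1
  · have h1 := summable_mittagLeffler (β := 0) hα le_rfl hα hT.le hc
    refine h1.congr fun l => ?_
    have := hterm l 0
    simpa using this
  · intro p
    have hp : T / ((p : ℝ) + 1) ∈ Icc 0 T :=
      ⟨by positivity, div_le_self hT.le (by linarith [p.cast_nonneg (α := ℝ)])⟩
    rw [← h _ hp, mittagLeffler]
    exact tsum_congr fun l => (hterm l p).symm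

/-- Log-convexity of the Gamma function: the quotients `Γ x / Γ (x + h)` decrease in `x`. -/
theorem Gamma_div_Gamma_add_anti {x y h : ℝ} (hx : 0 < x) (hxy : x ≤ y) (hh : 0 ≤ h) :
    Real.Gamma y / Real.Gamma (y + h) ≤ Real.Gamma x / Real.Gamma (x + h) := by
  rcases hh.eq_or_lt with rfl | hh
  · simp [(Real.Gamma_pos_of_pos hx).ne', (Real.Gamma_pos_of_pos (hx.trans_le hxy)).ne']
  have hy : 0 < y := hx.trans_le hxy
  have hd : 0 < y - x + h := by linarith
  have hcv := Real.convexOn_log_Gamma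
  have h1 := hcv.2 (mem_Ioi.2 hx) (mem_Ioi.2 (by linarith : 0 < y + h))
    (div_nonneg (by linarith : 0 ≤ y - x) hd.le) (div_nonneg hh.le hd.le)
    (by field_simp)
  have h2 := hcv.2 (mem_Ioi.2 hx) (mem_Ioi.2 (by linarith : 0 < y + h))
    (div_nonneg hh.le hd.le) (div_nonneg (by linarith : 0 ≤ y - x) hd.le)
    (by rw [← add_div, add_comm h, div_self hd.ne'])
  have e1 : ((y - x) / (y - x + h)) • x + (h / (y - x + h)) • (y + h) = x + h := by
    simp only [smul_eq_mul]; field_simp; ring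
  have e2 : (h / (y - x + h)) • x + ((y - x) / (y - x + h)) • (y + h) = y := by
    simp only [smul_eq_mul]; field_simp; ring
  rw [e1] at h1
  rw [e2] at h2
  simp only [Function.comp_apply, smul_eq_mul] at h1 h2
  have h3 : Real.log (Real.Gamma (x + h)) + Real.log (Real.Gamma y) ≤
      Real.log (Real.Gamma x) + Real.log (Real.Gamma (y + h)) := by
    have e3 : (y - x) / (y - x + h) + h / (y - x + h) = 1 := by field_simp
    calc _ ≤ ((y - x) / (y - x + h) + h / (y - x + h)) * Real.log (Real.Gamma x) +
          ((y - x) / (y - x + h) + h / (y - x + h)) * Real.log (Real.Gamma (y + h)) := by linarith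
      _ = _ := by rw [e3]; ring
  have p1 := Real.Gamma_pos_of_pos hx
  have p2 := Real.Gamma_pos_of_pos hy
  have p3 := Real.Gamma_pos_of_pos (by linarith : 0 < x + h)
  have p4 := Real.Gamma_pos_of_pos (by linarith : 0 < y + h)
  rw [← Real.log_mul p3.ne' p2.ne', ← Real.log_mul p1.ne' p4.ne'] at h3
  have h4 := (Real.log_le_log_iff (by positivity) (by positivity)).1 h3
  rw [div_le_div_iff₀ p4 p3]
  linarith

theorem Gamma_div_Gamma_add_le {x h : ℝ} (hx : 1 < x) (hh : 0 < h) :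
    Real.Gamma x / Real.Gamma (x + h) ≤ ((x - 1) ^ h)⁻¹ := by
  have p0 := Real.Gamma_pos_of_pos (by linarith : 0 < x - 1)
  have p1 := Real.Gamma_pos_of_pos (by linarith : 0 < x)
  have p2 := Real.Gamma_pos_of_pos (by linarith : 0 < x + h)
  have h1 := Real.convexOn_log_Gamma.slope_mono_adjacent (x := x - 1) (y := x) (z := x + h)
    (mem_Ioi.2 (by linarith)) (mem_Ioi.2 (by linarith)) (by linarith) (by linarith)
  simp only [Function.comp_apply, sub_sub_cancel, div_one, add_sub_cancel_left] at h1
  have h2 : Real.Gamma x = (x - 1) * Real.Gamma (x - 1) := by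
    simpa using Real.Gamma_add_one (s := x - 1) (by linarith)
  rw [← Real.log_div p1.ne' p0.ne', h2, mul_div_cancel_right₀ _ p0.ne', ← h2, le_div_iff₀ hh,
    ← Real.log_div p2.ne' p1.ne', mul_comm, ← Real.log_rpow (by linarith)] at h1
  have h3 := (Real.log_le_log_iff (Real.rpow_pos_of_pos (by linarith) _) (by positivity)).1 h1
  rw [← inv_div]
  exact inv_anti₀ (Real.rpow_pos_of_pos (by linarith) _) h3

/-- The values at a fixed time of the responses to the controls `t ^ p`, for all `p`, determine the
coefficients. -/
theorem eq_zero_of_mittagLeffler_nat_shift_eq_zero {α T : ℝ} (hα : 0 < α) (hT : 0 < T) {c : ℕ → ℝ}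
    (hc : IsGeomBounded c) (h : ∀ p : ℕ, mittagLeffler α (α + p) (α + p + 1) c T = 0) (l : ℕ) :
    c l = 0 := by
  have hG : ∀ l p : ℕ, 0 < Real.Gamma (α * l + (α + p + 1)) := fun l p =>
    Real.Gamma_pos_of_pos (by positivity)
  have hquot : ∀ l₀ l p : ℕ, l₀ ≤ l →
      (T ^ (α * l + (α + p)) / Real.Gamma (α * l + (α + p + 1))) /
      (T ^ (α * l₀ + (α + p)) / Real.Gamma (α * l₀ + (α + p + 1))) =
      T ^ (α * l - α * l₀) * (Real.Gamma (α * l₀ + (α + p + 1)) /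
        Real.Gamma (α * l₀ + (α + p + 1) + (α * l - α * l₀))) := by
    intro l₀ l p hl
    have e1 : α * l₀ + (α + p + 1) + (α * l - α * l₀) = α * l + (α + p + 1) := by ring
    have e2 : T ^ (α * l + (α + p)) = T ^ (α * l - α * l₀) * T ^ (α * l₀ + (α + p)) := by
      rw [← Real.rpow_add hT]; congr 1; ring
    have := (hG l₀ p).ne'
    have := (hG l p).ne'
    have : T ^ (α * l₀ + (α + p)) ≠ 0 := by positivity
    rw [e1, e2]
    field_simp
  refine eq_zero_of_asymptotic_scale
    (ω := fun l p => T ^ (α * l + (α + p)) / Real.Gamma (α * l + (α + p + 1)))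
    (fun l p => div_pos (by positivity) (hG l p)) ?_ ?_ ?_ ?_ l
  · intro l₀ l p hl
    rw [hquot l₀ l p hl, hquot l₀ l 0 hl]
    have hl' : (l₀ : ℝ) ≤ l := by exact_mod_cast hl
    apply mul_le_mul_of_nonneg_left _ (by positivity)
    apply Gamma_div_Gamma_add_anti
    · positivity
    · simp
    · nlinarith
  · intro l₀ l hl
    have hl' : (l₀ : ℝ) < l := by exact_mod_cast hl
    have hh : 0 < α * l - α * l₀ := by nlinarith
    simp only [hquot l₀ l _ hl.le]
    rw [← mul_zero (T ^ (α * l - α * l₀))]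
    apply Tendsto.const_mul
    have h1 : Tendsto (fun p : ℕ => ((p : ℝ) ^ (α * l - α * l₀))⁻¹) atTop (𝓝 0) :=
      ((tendsto_rpow_atTop hh).comp tendsto_natCast_atTop_atTop).inv_tendsto_atTop
    refine tendsto_of_tendsto_of_tendsto_of_le_of_le' tendsto_const_nhds h1 ?_ ?_
    · filter_upwards with p
      apply div_nonneg (hG l₀ p).le
      exact (Real.Gamma_pos_of_pos (by positivity)).le
    · filter_upwards [eventually_gt_atTop 0] with p hp
      have hp' : (0 : ℝ) < p := by exact_mod_cast hp
      have hq : 0 ≤ α * (l₀ : ℝ) := by positivity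
      refine (Gamma_div_Gamma_add_le (by linarith) hh).trans ?_
      apply inv_anti₀ (by positivity)
      apply Real.rpow_le_rpow hp'.le _ hh.le
      linarith
  · have h1 := summable_mittagLeffler (β := α + (0 : ℕ)) (γ := α + (0 : ℕ) + 1) hα (by positivity)
      (by positivity) hT.le hc
    refine h1.congr fun l => ?_
    rw [smul_eq_mul, mul_comm]
  · intro p
    rw [← h p, mittagLeffler]
    exact tsum_congr fun l => by rw [smul_eq_mul, mul_comm]

end AsymptoticScale

/-! ### Rank conditions -/

section RankConditions

variable {n m : ℕ}

theorem rank_eq_iff_vecMul {K ι : Type*} [Field K] [Fintype ι] (M : Matrix (Fin n) ι K) :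
    M.rank = n ↔ ∀ v, Matrix.vecMul v M = 0 → v = 0 := by
  have h1 : (∀ v, Matrix.vecMul v M = 0 → v = 0) ↔ Function.Injective M.vecMul := by
    have := injective_iff_map_eq_zero (Matrix.vecMulLinear M)
    exact this.symm
  rw [h1, Matrix.vecMul_injective_iff, linearIndependent_iff_card_eq_finrank_span,
    Matrix.rank_eq_finrank_span_row, Set.finrank, Fintype.card_fin, eq_comm]

/-- Powers of `A` beyond the degree of the minimal polynomial add nothing to the rank of the
controllability matrix. -/
theorem vecMul_controllabilityMatrix_eq_zero_iff (A : Matrix (Fin n) (Fin n) ℝ)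
    (B : Matrix (Fin n) (Fin m) ℝ) (v : Fin n → ℝ) :
    Matrix.vecMul v (controllabilityMatrix A B) = 0 ↔
      ∀ l : ℕ, Matrix.vecMul v (A ^ l * B) = 0 := by
  have h0 : Matrix.vecMul v (controllabilityMatrix A B) = 0 ↔
      ∀ l < (minpoly ℝ A).natDegree, Matrix.vecMul v (A ^ l * B) = 0 := by
    constructor
    · intro h l hl
      ext j
      simpa [controllabilityMatrix, Matrix.vecMul, dotProduct] using congrFun h (⟨l, hl⟩, j)
    · intro h
      ext ⟨l, j⟩
      simpa [controllabilityMatrix, Matrix.vecMul, dotProduct] using congrFun (h l l.2) j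
  rw [h0]
  refine ⟨fun h l => ?_, fun h l _ => h l⟩
  have hmonic : (minpoly ℝ A).Monic := minpoly.monic (Algebra.IsIntegral.isIntegral A)
  have hA : A ^ l = Polynomial.aeval A ((Polynomial.X : Polynomial ℝ) ^ l %ₘ minpoly ℝ A) := by
    conv_lhs => rw [← Polynomial.aeval_X (R := ℝ) A, ← map_pow,
      ← Polynomial.modByMonic_add_div (Polynomial.X ^ l) (minpoly ℝ A)]
    simp
  by_cases hdeg : minpoly ℝ A = 1
  · rw [hA, hdeg, Polynomial.modByMonic_one]
    simp
  have hlt := Polynomial.natDegree_modByMonic_lt (Polynomial.X ^ l) hmonic hdeg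
  rw [hA, Polynomial.aeval_eq_sum_range, Matrix.sum_mul]
  have h2 : Matrix.vecMul v (∑ i ∈ Finset.range
      (((Polynomial.X : Polynomial ℝ) ^ l %ₘ minpoly ℝ A).natDegree + 1),
        (((Polynomial.X : Polynomial ℝ) ^ l %ₘ minpoly ℝ A).coeff i • A ^ i) * B) =
      ∑ i ∈ Finset.range (((Polynomial.X : Polynomial ℝ) ^ l %ₘ minpoly ℝ A).natDegree + 1),
        Matrix.vecMul v
          ((((Polynomial.X : Polynomial ℝ) ^ l %ₘ minpoly ℝ A).coeff i • A ^ i) * B) :=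
    map_sum (Matrix.vecMulBilin ℝ ℝ v) _ _
  rw [h2]
  apply Finset.sum_eq_zero
  intro i hi
  rw [Matrix.smul_mul, Matrix.vecMul_smul, h i (by rw [Finset.mem_range] at hi; omega), smul_zero]

theorem rank_controllabilityMatrix_iff (A : Matrix (Fin n) (Fin n) ℝ)
    (B : Matrix (Fin n) (Fin m) ℝ) :
    (controllabilityMatrix A B).rank = n ↔
      ∀ v, (∀ l : ℕ, Matrix.vecMul v (A ^ l * B) = 0) → v = 0 := by
  rw [rank_eq_iff_vecMul]
  simp only [vecMul_controllabilityMatrix_eq_zero_iff]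

theorem rank_pbhMatrix_iff (A : Matrix (Fin n) (Fin n) ℝ)
    (B : Matrix (Fin n) (Fin m) ℝ) (z : ℂ) :
    (pbhMatrix A B z).rank = n ↔
      ∀ w, Matrix.vecMul w (A.map Complex.ofReal) = z • w →
        Matrix.vecMul w (B.map Complex.ofReal) = 0 → w = 0 := by
  rw [rank_eq_iff_vecMul]
  refine forall_congr' fun w => ?_
  rw [← and_imp]
  apply imp_congr_left
  rw [pbhMatrix, Matrix.vecMul_fromCols, Matrix.vecMul_sub, Matrix.vecMul_smul, Matrix.vecMul_one]
  constructor
  · intro h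
    constructor
    · ext j
      have := congrFun h (Sum.inl j)
      simpa [sub_eq_zero, eq_comm] using this
    · ext j
      exact congrFun h (Sum.inr j)
  · rintro ⟨h1, h2⟩
    rw [h1, h2]
    ext (j | j) <;> simp

theorem mem_spectrum_of_vecMul_eq_smul {M : Matrix (Fin n) (Fin n) ℂ} {z : ℂ} {w : Fin n → ℂ}
    (hw : w ≠ 0) (h : Matrix.vecMul w M = z • w) : z ∈ spectrum ℂ M := by
  rw [spectrum.mem_iff]
  intro hu
  rw [← Matrix.vecMul_injective_iff_isUnit] at hu
  apply hw
  apply hu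
  simp [Matrix.vecMul_sub, h, Algebra.algebraMap_eq_smul_one, Matrix.vecMul_smul]

/-- The Popov-Belevitch-Hautus test: a nonzero vector annihilated by all `A ^ l B` lies in
the space of all such complex vectors, which is invariant and so contains a left eigenvector. -/
theorem rank_controllabilityMatrix_of_rank_pbhMatrix (A : Matrix (Fin n) (Fin n) ℝ)
    (B : Matrix (Fin n) (Fin m) ℝ)
    (h : ∀ z ∈ spectrum ℂ (A.map Complex.ofReal), (pbhMatrix A B z).rank = n) :
    (controllabilityMatrix A B).rank = n := by
  rw [rank_controllabilityMatrix_iff]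
  intro v hv
  by_contra hv0
  set M : Matrix (Fin n) (Fin n) ℂ := A.map Complex.ofReal with hM
  set N : Matrix (Fin n) (Fin m) ℂ := B.map Complex.ofReal with hN
  let V : Submodule ℂ (Fin n → ℂ) := ⨅ l : ℕ, LinearMap.ker (Matrix.vecMulLinear (M ^ l * N))
  have hV : ∀ w, w ∈ V ↔ ∀ l : ℕ, Matrix.vecMul w (M ^ l * N) = 0 := by
    intro w; simp [V, Submodule.mem_iInf]
  have hinv : ∀ w ∈ V, Matrix.vecMulLinear M w ∈ V := by
    intro w hw
    rw [hV] at hw ⊢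
    intro l
    rw [Matrix.vecMulLinear_apply, Matrix.vecMul_vecMul, ← Matrix.mul_assoc, ← pow_succ']
    exact hw (l + 1)
  have hcv : (fun i => (v i : ℂ)) ∈ V := by
    rw [hV]
    intro l
    have h1 : M ^ l * N = (A ^ l * B).map Complex.ofReal := by
      have hp : M ^ l = (A ^ l).map Complex.ofReal :=
        (map_pow (Complex.ofRealHom.mapMatrix (m := Fin n)) A l).symm
      rw [hp]
      exact (Matrix.map_mul (f := Complex.ofRealHom)).symm
    ext j
    have h2 := congrArg (Complex.ofReal) (congrFun (hv l) j)
    rw [h1]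
    simpa [Matrix.vecMul, dotProduct] using h2
  have : Nontrivial V := by
    refine ⟨⟨⟨_, hcv⟩, 0, fun h0 => hv0 ?_⟩⟩
    ext i
    have := congrFun (congrArg Subtype.val h0) i
    simpa using this
  obtain ⟨z, hz⟩ := Module.End.exists_eigenvalue ((Matrix.vecMulLinear M).restrict hinv)
  obtain ⟨w, hw⟩ := hz.exists_hasEigenvector
  have hw1 : Matrix.vecMul (w : Fin n → ℂ) M = z • (w : Fin n → ℂ) :=
    congrArg Subtype.val hw.apply_eq_smul
  have hw0 : (w : Fin n → ℂ) ≠ 0 := fun h0 => hw.2 (Subtype.ext h0)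
  have hw2 : Matrix.vecMul (w : Fin n → ℂ) N = 0 := by simpa using (hV _).1 w.2 0
  exact hw0 ((rank_pbhMatrix_iff A B z).1 (h z (mem_spectrum_of_vecMul_eq_smul hw0 hw1)) _ hw1 hw2)

end RankConditions

/-! ### Uniqueness for the homogeneous equation and necessity of the Hautus condition -/

section Uniqueness

variable {E F : Type*} [NormedAddCommGroup E] [NormedSpace ℝ E]
  [NormedAddCommGroup F] [NormedSpace ℝ F]

theorem hasDerivWithinAt_iteratedDerivWithin {T t : ℝ} (hT : 0 < T) {N i : ℕ} {y : ℝ → E}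
    (hy : ContDiffOn ℝ (N : WithTop ℕ∞) y (Icc 0 T)) (hi : i < N) (ht : t ∈ Icc 0 T) :
    HasDerivWithinAt (iteratedDerivWithin i y (Icc 0 T))
      (iteratedDerivWithin (i + 1) y (Icc 0 T) t) (Icc 0 T) t := by
  rw [iteratedDerivWithin_succ]
  exact (hy.differentiableOn_iteratedDerivWithin (by exact_mod_cast hi)
    (uniqueDiffOn_Icc hT) t ht).hasDerivWithinAt

theorem iteratedDerivWithin_clm_comp (L : E →L[ℝ] F) {T : ℝ} (hT : 0 < T) {N i : ℕ} {y : ℝ → E}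
    (hy : ContDiffOn ℝ (N : WithTop ℕ∞) y (Icc 0 T)) (hi : i ≤ N) :
    EqOn (iteratedDerivWithin i (fun t => L (y t)) (Icc 0 T))
      (fun t => L (iteratedDerivWithin i y (Icc 0 T) t)) (Icc 0 T) := by
  have h := iteratedDerivWithin_of_chain hT (N := N)
    (F := fun i t => L (iteratedDerivWithin i y (Icc 0 T) t)) (by
      intro j hj t ht
      exact L.hasFDerivAt.comp_hasDerivWithinAt t
        (hasDerivWithinAt_iteratedDerivWithin hT hy hj ht)) hi
  simpa using h

/-- Taylor's formula with integral remainder, for vanishing initial values. -/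
theorem eq_rlIntegral_iteratedDerivWithin [CompleteSpace E] {T : ℝ} (hT : 0 < T) {N : ℕ}
    {y : ℝ → E} (hy : ContDiffOn ℝ (N : WithTop ℕ∞) y (Icc 0 T))
    (h0 : ∀ j < N, iteratedDerivWithin j y (Icc 0 T) 0 = 0) {j : ℕ} (hj : j ≤ N) :
    EqOn y (rlIntegral j (iteratedDerivWithin j y (Icc 0 T))) (Icc 0 T) := by
  have hcont : ∀ j ≤ N, ContinuousOn (iteratedDerivWithin j y (Icc 0 T)) (Icc 0 T) := fun j hj =>
    hy.continuousOn_iteratedDerivWithin (by exact_mod_cast hj) (uniqueDiffOn_Icc hT)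
  induction j with
  | zero => intro t _; simp [rlIntegral_zero_order]
  | succ j ih =>
    have h1 : EqOn (iteratedDerivWithin j y (Icc 0 T))
        (rlIntegral 1 (iteratedDerivWithin (j + 1) y (Icc 0 T))) (Icc 0 T) := by
      intro t ht
      have hsub : Icc 0 t ⊆ Icc 0 T := Icc_subset_Icc_right ht.2
      rw [rlIntegral_one, integral_eq_of_hasDerivAt_off_countable_of_le
        (iteratedDerivWithin j y (Icc 0 T)) _ ht.1 countable_empty
        ((hcont j (by omega)).mono hsub), h0 j (by omega), sub_zero]
      · intro s hs
        exact (hasDerivWithinAt_iteratedDerivWithin hT hy (by omega)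
          (hsub (Ioo_subset_Icc_self hs.1))).hasDerivAt
            (Icc_mem_nhds hs.1.1 (hs.1.2.trans_le ht.2))
      · apply ContinuousOn.intervalIntegrable
        rw [uIcc_of_le ht.1]
        exact (hcont (j + 1) hj).mono hsub
    intro t ht
    rw [ih (by omega) ht, rlIntegral_congr h1 ht,
      rlIntegral_rlIntegral (by positivity) zero_le_one (hcont (j + 1) hj) ht]
    push_cast
    rfl

theorem rlIntegral_const_mul {b t : ℝ} (z : ℂ) (hb : 0 ≤ b) (ht : 0 ≤ t) {f : ℝ → ℂ}
    (hf : ContinuousOn f (Icc 0 t)) :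
    rlIntegral b (fun s => z * f s) t = z * rlIntegral b f t :=
  rlIntegral_clm_comp (ContinuousLinearMap.mul ℝ ℂ z) hb ht hf

/-- The homogeneous Volterra equation with kernel `z (t - s) ^ (α - 1) / Γ(α)` has only the zero
solution: iterating it `N` times bounds a solution by the `N`-th term of a convergent series. -/
theorem eq_zero_of_eq_mul_rlIntegral {α T : ℝ} (hα : 0 < α) {z : ℂ} {g : ℝ → ℂ}
    (hg : ContinuousOn g (Icc 0 T)) (h : ∀ t ∈ Icc 0 T, g t = z * rlIntegral α g t) :
    ∀ t ∈ Icc 0 T, g t = 0 := by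
  intro t ht
  have hiter : ∀ N : ℕ, g t = z ^ N * rlIntegral (α * N) g t := by
    intro N
    induction N with
    | zero => simp [rlIntegral_zero_order]
    | succ N ih =>
      have hN : 0 ≤ α * (N : ℝ) := by positivity
      have hgt := (continuousOn_rlIntegral hα.le hg).mono (Icc_subset_Icc_right ht.2)
      rw [ih, rlIntegral_congr (b := α * N) h ht, rlIntegral_const_mul z hN ht.1 hgt,
        rlIntegral_rlIntegral hN hα.le hg ht, pow_succ, mul_assoc]
      congr 4
      push_cast; ring
  obtain ⟨M, hM⟩ := isCompact_Icc.exists_bound_of_continuousOn hg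
  have hC : 0 ≤ ‖z‖ * t ^ α := mul_nonneg (norm_nonneg _) (Real.rpow_nonneg ht.1 _)
  have hlim := ((summable_pow_div_Gamma (γ := 1) hα hC).tendsto_atTop_zero).const_mul M
  rw [mul_zero] at hlim
  rw [← norm_le_zero_iff]
  refine ge_of_tendsto' hlim fun N => ?_
  have hN : 0 ≤ α * (N : ℝ) := by positivity
  rw [hiter N, norm_mul, norm_pow]
  calc ‖z‖ ^ N * ‖rlIntegral (α * N) g t‖
      ≤ ‖z‖ ^ N * (M * (t ^ (α * N) / Real.Gamma (α * N + 1))) := by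
        gcongr
        exact norm_rlIntegral_le hN ht.1 fun s hs => hM s ⟨hs.1, hs.2.trans ht.2⟩
    _ = M * ((‖z‖ * t ^ α) ^ N / Real.Gamma (α * N + 1)) := by
        rw [Real.rpow_mul_natCast ht.1, mul_pow]; ring

/-- The scalar homogeneous Caputo equation with vanishing initial values has only the zero
solution, also when the equation is allowed to fail at finitely many points. -/
theorem eq_zero_of_caputo_homogeneous {k : ℕ} {α T : ℝ} (hk : 1 ≤ k) (hα : (k : ℝ) - 1 < α)
    (hα' : α ≤ k) (hT : 0 < T) {z : ℂ} {y : ℝ → ℂ}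
    (hy : ContDiffOn ℝ ((k - 1 : ℕ) : WithTop ℕ∞) y (Icc 0 T))
    (h0 : ∀ j < k, iteratedDerivWithin j y (Icc 0 T) 0 = 0) {S : Set ℝ} (hS : S.Countable)
    (heq : ∀ t ∈ Ioo 0 T \ S,
      HasDerivAt (iteratedDerivWithin (k - 1) (rlIntegral ((k : ℝ) - α) y) (Icc 0 T))
        (z * y t) t) :
    ∀ t ∈ Icc 0 T, y t = 0 := by
  have hk1 : ((k - 1 : ℕ) : ℝ) = k - 1 := by rw [Nat.cast_sub hk, Nat.cast_one]
  have hk0 : (1 : ℝ) ≤ k := by exact_mod_cast hk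
  have hα0 : 0 < α := by linarith
  have hb : 0 ≤ (k : ℝ) - α := by linarith
  have hT0 : (0 : ℝ) ∈ Icc 0 T := ⟨le_rfl, hT.le⟩
  set g := iteratedDerivWithin (k - 1) y (Icc 0 T) with hgdef
  have hg : ContinuousOn g (Icc 0 T) :=
    hy.continuousOn_iteratedDerivWithin le_rfl (uniqueDiffOn_Icc hT)
  have hyg : EqOn y (rlIntegral (k - 1 : ℕ) g) (Icc 0 T) :=
    eq_rlIntegral_iteratedDerivWithin hT hy (fun j hj => h0 j (by omega)) le_rfl
  have hyc : ContinuousOn y (Icc 0 T) := hy.continuousOn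
  -- The fractional integral of `y` is the `(k - 1)`-fold integral of `h := I ^ (k - α) g`.
  have hP : EqOn (rlIntegral ((k : ℝ) - α) y) (rlIntegral ((k - 1 : ℕ) + ((k : ℝ) - α)) g)
      (Icc 0 T) := by
    intro t ht
    rw [rlIntegral_congr hyg ht, rlIntegral_rlIntegral hb (by positivity) hg ht, add_comm]
  have hD : EqOn (iteratedDerivWithin (k - 1) (rlIntegral ((k : ℝ) - α) y) (Icc 0 T))
      (rlIntegral ((k : ℝ) - α) g) (Icc 0 T) := by
    intro t ht
    rw [iteratedDerivWithin_congr hP ht,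
      iteratedDerivWithin_rlIntegral hT hb (k - 1) hg le_rfl ht]
    simp
  have hh0 : rlIntegral ((k : ℝ) - α) g 0 = 0 := by
    rcases hb.eq_or_lt with hb0 | hb0
    · rw [← hb0, rlIntegral_zero_order]; exact h0 _ (by omega)
    · exact rlIntegral_at_zero hb0 g
  have hhc : ContinuousOn (rlIntegral ((k : ℝ) - α) g) (Icc 0 T) := continuousOn_rlIntegral hb hg
  have hh : EqOn (rlIntegral ((k : ℝ) - α) g) (fun t => z * rlIntegral k g t) (Icc 0 T) := by
    intro t ht
    have hsub : Icc 0 t ⊆ Icc 0 T := Icc_subset_Icc_right ht.2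
    have h1 := integral_eq_of_hasDerivAt_off_countable_of_le
      (rlIntegral ((k : ℝ) - α) g) (fun s => z * y s) ht.1 hS (hhc.mono hsub) (by
        intro s hs
        have hsT : s ∈ Ioo 0 T := ⟨hs.1.1, hs.1.2.trans_le ht.2⟩
        exact (heq s ⟨hsT, hs.2⟩).congr_of_eventuallyEq
          (hD.eventuallyEq_of_mem (Icc_mem_nhds hsT.1 hsT.2)).symm) (by
        apply ContinuousOn.intervalIntegrable
        rw [uIcc_of_le ht.1]
        exact continuousOn_const.mul (hyc.mono hsub))
    rw [hh0, sub_zero, ← rlIntegral_one,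
      rlIntegral_const_mul z zero_le_one ht.1 (hyc.mono hsub), rlIntegral_congr hyg ht,
      rlIntegral_rlIntegral zero_le_one (by positivity) hg ht, hk1, add_sub_cancel] at h1
    exact h1.symm
  have hIα : ContinuousOn (fun t => z * rlIntegral α g t) (Icc 0 T) :=
    continuousOn_const.mul (continuousOn_rlIntegral hα0.le hg)
  -- Integration of order `α - k + 1` gives `I ^ 1 g = I ^ 1 (z I ^ α g)`.
  have hI : EqOn (rlIntegral (0 + 1) g) (rlIntegral (0 + 1) (fun t => z * rlIntegral α g t))
      (Icc 0 T) := by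
    intro t ht
    have hsub : Icc 0 t ⊆ Icc 0 T := Icc_subset_Icc_right ht.2
    have hδ : 0 ≤ α - k + 1 := by linarith
    have h1 := rlIntegral_congr (b := α - k + 1) hh ht
    rw [rlIntegral_rlIntegral hδ hb hg ht, rlIntegral_const_mul z hδ ht.1
      ((continuousOn_rlIntegral (by linarith) hg).mono hsub),
      rlIntegral_rlIntegral hδ (by linarith) hg ht] at h1
    rw [rlIntegral_const_mul z (by norm_num) ht.1
      ((continuousOn_rlIntegral hα0.le hg).mono hsub),
      rlIntegral_rlIntegral (by norm_num) hα0.le hg ht]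
    rw [show α - k + 1 + ((k : ℝ) - α) = 0 + 1 by ring,
      show α - k + 1 + (k : ℝ) = 0 + 1 + α by ring] at h1
    exact h1
  have hgeq : ∀ t ∈ Icc 0 T, g t = z * rlIntegral α g t := by
    intro t ht
    have d1 := hasDerivWithinAt_rlIntegral le_rfl hg ht
    have d2 := (hasDerivWithinAt_rlIntegral le_rfl hIα ht).congr hI (hI ht)
    rw [rlIntegral_zero_order] at d1 d2
    rw [← d1.derivWithin (uniqueDiffOn_Icc hT t ht), d2.derivWithin (uniqueDiffOn_Icc hT t ht)]
  have hg0 : EqOn g (fun _ => 0) (Icc 0 T) := eq_zero_of_eq_mul_rlIntegral hα0 hg hgeq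
  intro t ht
  rw [hyg ht, rlIntegral_congr hg0 ht]
  simp [rlIntegral]

end Uniqueness

section Necessity

theorem caputoPrimitive_of_initial_zero {E : Type*} [NormedAddCommGroup E] [NormedSpace ℝ E]
    {k : ℕ} (hk : 1 ≤ k) (α : ℝ) {T : ℝ} {x : ℝ → E}
    (h0 : ∀ j < k, iteratedDerivWithin j x (Icc 0 T) 0 = 0) :
    caputoPrimitive k α T x = rlIntegral ((k : ℝ) - α) x := by
  unfold caputoPrimitive
  congr 1
  ext s
  rw [taylor_within_apply, Finset.sum_eq_zero, sub_zero]
  intro j hj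
  rw [h0 j (by rw [Finset.mem_range] at hj; omega), smul_zero]

/-- A left eigenvector `w` of `A` with `w B = 0` gives a functional of the state that solves a
homogeneous scalar equation, whatever the control: started at zero it stays zero. -/
theorem rank_pbhMatrix_of_controllable {n m k : ℕ} {α T : ℝ} (hk : 1 ≤ k)
    (hα : (k : ℝ) - 1 < α) (hα' : α ≤ k) (hT : 0 < T) {A : Matrix (Fin n) (Fin n) ℝ}
    {B : Matrix (Fin n) (Fin m) ℝ} (h : Controllable k α A B T) (z : ℂ) :
    (pbhMatrix A B z).rank = n := by
  rw [rank_pbhMatrix_iff]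
  intro w hw1 hw2
  by_contra hw0
  obtain ⟨i, hi⟩ := Function.ne_iff.1 hw0
  obtain ⟨u, x, hu, hx, hxT⟩ := h 0 (Pi.single i 1)
  let L : (Fin n → ℝ) →L[ℝ] ℂ := LinearMap.toContinuousLinearMap
    (∑ i, (LinearMap.proj i : (Fin n → ℝ) →ₗ[ℝ] ℝ).smulRight (w i))
  have hL : ∀ v, L v = w ⬝ᵥ (fun i => (v i : ℂ)) := by
    intro v
    simp [L, dotProduct, mul_comm]
  have hLA : ∀ v, L (A.mulVec v) = z * L v := by
    intro v
    have h1 : (fun i => (A.mulVec v i : ℂ)) =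
        (A.map Complex.ofReal).mulVec (fun i => (v i : ℂ)) := by
      ext i; simp [Matrix.mulVec, dotProduct]
    rw [hL, hL, h1, Matrix.dotProduct_mulVec, hw1, smul_dotProduct, smul_eq_mul]
  have hLB : ∀ v, L (B.mulVec v) = 0 := by
    intro v
    have h1 : (fun i => (B.mulVec v i : ℂ)) =
        (B.map Complex.ofReal).mulVec (fun i => (v i : ℂ)) := by
      ext i; simp [Matrix.mulVec, dotProduct]
    rw [hL, h1, Matrix.dotProduct_mulVec, hw2, zero_dotProduct]
  have hb : 0 ≤ (k : ℝ) - α := by linarith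
  have h0 : ∀ j < k, iteratedDerivWithin j x (Icc 0 T) 0 = 0 := fun j hj => hx.initial ⟨j, hj⟩
  have hP := caputoPrimitive_of_initial_zero hk α h0
  obtain ⟨S, hS⟩ := hu.continuousAt
  have hy := L.contDiff.comp_contDiffOn hx.contDiffOn
  have hLP : EqOn (fun t => L (caputoPrimitive k α T x t))
      (rlIntegral ((k : ℝ) - α) (fun t => L (x t))) (Icc 0 T) := by
    intro t ht
    rw [hP]
    exact (rlIntegral_clm_comp L hb ht.1
      (hx.contDiffOn.continuousOn.mono (Icc_subset_Icc_right ht.2))).symm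
  have hzero := eq_zero_of_caputo_homogeneous (z := z) hk hα hα' hT hy (by
      intro j hj
      have := iteratedDerivWithin_clm_comp L hT hx.contDiffOn (i := j) (by omega)
        (show (0 : ℝ) ∈ Icc 0 T from ⟨le_rfl, hT.le⟩)
      simp only [h0 j hj, map_zero] at this
      exact this)
    (S := S) S.countable_toSet (by
      intro t ht
      have h1 := L.hasFDerivAt.comp_hasDerivAt t
        (hx.equation t ht.1 (hS t ht.1 (by simpa using ht.2)))
      rw [map_add, hLA, hLB, add_zero] at h1
      refine h1.congr_of_eventuallyEq ?_
      filter_upwards [Icc_mem_nhds ht.1.1 ht.1.2] with s hs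
      have h2 := iteratedDerivWithin_clm_comp L hT hx.contDiffOn_primitive le_rfl hs
      have h3 := iteratedDerivWithin_congr (n := k - 1) hLP hs
      exact h3.symm.trans h2)
  have := hzero T ⟨hT.le, le_rfl⟩
  simp only [Function.comp_apply, hxT] at this
  rw [hL] at this
  apply hi
  have h3 : (fun j => ((Pi.single i (1 : ℝ) : Fin n → ℝ) j : ℂ)) = Pi.single i 1 := by
    ext j
    by_cases hj : j = i
    · subst hj; simp
    · simp [hj]
  rw [h3] at this
  simpa using this

end Necessity

/-! ### Reachability and the Gramian -/

section Reachability

variable {n m : ℕ}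

theorem continuousOn_mulVec_add {T : ℝ} (A : Matrix (Fin n) (Fin n) ℝ)
    (B : Matrix (Fin n) (Fin m) ℝ) {x : ℝ → Fin n → ℝ} {u : ℝ → Fin m → ℝ}
    (hx : ContinuousOn x (Icc 0 T)) (hu : Continuous u) :
    ContinuousOn (fun s => A.mulVec (x s) + B.mulVec (u s)) (Icc 0 T) := by
  apply ContinuousOn.add
  · exact (LinearMap.continuous_of_finiteDimensional A.mulVecLin).comp_continuousOn hx
  · exact ((LinearMap.continuous_of_finiteDimensional B.mulVecLin).comp hu).continuousOn

theorem isAdmissible_of_continuous (T : ℝ) {u : ℝ → Fin m → ℝ} (hu : Continuous u) :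
    IsAdmissible T u where
  bounded := isCompact_Icc.exists_bound_of_continuousOn hu.continuousOn
  continuousAt := ⟨∅, fun _ _ _ => hu.continuousAt⟩
  rightLimit t _ := ⟨u t, (hu.tendsto t).mono_left nhdsWithin_le_nhds⟩
  leftLimit t _ := ⟨u t, (hu.tendsto t).mono_left nhdsWithin_le_nhds⟩

/-- The states attained at time `T` from vanishing initial values by continuous controls, in terms
of the Volterra integral equation of the system. -/
def reachable {α : ℝ} (hα : 0 < α) (T : ℝ) (A : Matrix (Fin n) (Fin n) ℝ)
    (B : Matrix (Fin n) (Fin m) ℝ) : Submodule ℝ (Fin n → ℝ) where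
  carrier := {y | ∃ (u : ℝ → Fin m → ℝ) (x : ℝ → Fin n → ℝ), Continuous u ∧
    ContinuousOn x (Icc 0 T) ∧
    (∀ t ∈ Icc 0 T, x t = rlIntegral α (fun s => A.mulVec (x s) + B.mulVec (u s)) t) ∧ x T = y}
  zero_mem' := by
    refine ⟨0, 0, continuous_zero, continuousOn_const, fun t _ => ?_, rfl⟩
    simp [rlIntegral]
  add_mem' := by
    rintro _ _ ⟨u, x, hu, hx, h, rfl⟩ ⟨u', x', hu', hx', h', rfl⟩
    refine ⟨fun t => u t + u' t, fun t => x t + x' t, hu.add hu', hx.add hx', fun t ht => ?_, rfl⟩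
    have hsub : Icc 0 t ⊆ Icc 0 T := Icc_subset_Icc_right ht.2
    simp only
    rw [h t ht, h' t ht, ← rlIntegral_add hα.le ht.1
      ((continuousOn_mulVec_add A B hx hu).mono hsub)
      ((continuousOn_mulVec_add A B hx' hu').mono hsub)]
    congr 1
    ext1 s
    rw [Matrix.mulVec_add, Matrix.mulVec_add]
    abel
  smul_mem' := by
    rintro r _ ⟨u, x, hu, hx, h, rfl⟩
    refine ⟨fun t => r • u t, fun t => r • x t, hu.const_smul r, hx.const_smul r,
      fun t ht => ?_, rfl⟩
    have hsub : Icc 0 t ⊆ Icc 0 T := Icc_subset_Icc_right ht.2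
    have h1 := rlIntegral_clm_comp (r • ContinuousLinearMap.id ℝ (Fin n → ℝ)) hα.le ht.1
      ((continuousOn_mulVec_add A B hx hu).mono hsub)
    change rlIntegral α (fun s => r • (A.mulVec (x s) + B.mulVec (u s))) t =
      r • rlIntegral α (fun s => A.mulVec (x s) + B.mulVec (u s)) t at h1
    simp only
    conv_lhs => rw [h t ht, ← h1]
    congr 1
    ext1 s
    rw [Matrix.mulVec_smul, Matrix.mulVec_smul, smul_add]

/-- The control `t ^ p / p! b` attains the value of a Mittag-Leffler series. -/
theorem mittagLeffler_mem_reachable {α : ℝ} (hα : 0 < α) (T : ℝ)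
    (A : Matrix (Fin n) (Fin n) ℝ) (B : Matrix (Fin n) (Fin m) ℝ) (b : Fin m → ℝ) (p : ℕ) :
    mittagLeffler α (α + p) (α + p + 1) (fun l => (A ^ l).mulVec (B.mulVec b)) T ∈
      reachable hα T A B := by
  set x := mittagLeffler α (α + p) (α + p + 1) (fun l => (A ^ l).mulVec (B.mulVec b)) with hx
  have hβ : 0 ≤ α + (p : ℝ) := by positivity
  have hxc : ContinuousOn x (Icc 0 T) :=
    continuousOn_mittagLeffler hα hβ (by positivity) (isGeomBounded_pow_mulVec A _)
  have huc : Continuous fun s : ℝ => (s ^ p / p.factorial : ℝ) • b := by fun_prop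
  refine ⟨fun s => (s ^ p / p.factorial : ℝ) • b, x, huc, hxc, fun t ht => ?_, rfl⟩
  have hsub : Icc 0 t ⊆ Icc 0 T := Icc_subset_Icc_right ht.2
  have hAc : ContinuousOn (fun s => A.mulVec (x s)) (Icc 0 t) :=
    (LinearMap.continuous_of_finiteDimensional A.mulVecLin).comp_continuousOn (hxc.mono hsub)
  have hBc : ContinuousOn (fun s : ℝ => B.mulVec ((s ^ p / p.factorial : ℝ) • b)) (Icc 0 t) :=
    ((LinearMap.continuous_of_finiteDimensional B.mulVecLin).comp huc).continuousOn
  rw [rlIntegral_add hα.le ht.1 hAc hBc]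
  have h1 := mittagLeffler_pow_mulVec_eq A (B.mulVec b) hα hβ ht.1
  rw [← hx] at h1
  rw [h1, add_comm]
  congr 1
  have h2 := rlIntegral_rpow_smul hα.le p.cast_nonneg ht.1
    ((p.factorial : ℝ)⁻¹ • B.mulVec b)
  have hp : (p.factorial : ℝ) ≠ 0 := by positivity
  have e : (fun s : ℝ => B.mulVec ((s ^ p / p.factorial : ℝ) • b)) =
      fun s : ℝ => s ^ (p : ℝ) • ((p.factorial : ℝ)⁻¹ • B.mulVec b) := by
    ext1 s
    rw [Matrix.mulVec_smul, smul_smul, Real.rpow_natCast, div_eq_mul_inv]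
  rw [e, h2, smul_smul, Real.Gamma_nat_eq_factorial, add_comm (p : ℝ) α]
  congr 1
  field_simp

theorem reachable_eq_top {α T : ℝ} (hα : 0 < α) (hT : 0 < T)
    {A : Matrix (Fin n) (Fin n) ℝ} {B : Matrix (Fin n) (Fin m) ℝ}
    (h : (controllabilityMatrix A B).rank = n) : reachable hα T A B = ⊤ := by
  rw [rank_controllabilityMatrix_iff] at h
  by_contra htop
  obtain ⟨f, hf0, hf⟩ := Submodule.exists_le_ker_of_lt_top _ (lt_top_iff_ne_top.2 htop)
  let L : (Fin n → ℝ) →L[ℝ] ℝ := LinearMap.toContinuousLinearMap f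
  have hzero : ∀ (b : Fin m → ℝ) (l : ℕ), f ((A ^ l).mulVec (B.mulVec b)) = 0 := by
    intro b
    have hc := isGeomBounded_pow_mulVec A (B.mulVec b)
    refine eq_zero_of_mittagLeffler_nat_shift_eq_zero hα hT (hc.clm L) fun p => ?_
    refine (clm_mittagLeffler L hα (by positivity) (by positivity) hT.le hc).symm.trans ?_
    exact LinearMap.mem_ker.1 (hf (mittagLeffler_mem_reachable hα T A B b p))
  set v : Fin n → ℝ := fun i => f (Pi.single i 1) with hv
  have hfv : ∀ y, f y = v ⬝ᵥ y := by
    intro y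
    conv_lhs => rw [← Matrix.one_mulVec y, Matrix.mulVec_eq_sum]
    rw [map_sum]
    apply Finset.sum_congr rfl
    intro i _
    rw [hv]
    simp only [op_smul_eq_smul, map_smul, smul_eq_mul, mul_comm (y i)]
    congr 2
    ext j
    simp [Matrix.one_apply, Pi.single_apply, eq_comm]
  have hv0 : v = 0 := by
    apply h
    intro l
    ext j
    have h1 := hzero (Pi.single j 1) l
    rw [hfv, Matrix.mulVec_mulVec, Matrix.dotProduct_mulVec] at h1
    simpa using h1
  apply hf0
  ext1 i
  ext
  simpa using congrFun hv0 i

/-- The free motion with prescribed initial values, a sum of Mittag-Leffler series. -/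
theorem exists_free_solution {α T : ℝ} (hα : 0 < α) (A : Matrix (Fin n) (Fin n) ℝ)
    (c : ℕ → Fin n → ℝ) (k : ℕ) :
    ∃ x : ℝ → Fin n → ℝ, ContinuousOn x (Icc 0 T) ∧ ∀ t ∈ Icc 0 T,
      x t = (∑ j ∈ Finset.range k, (t ^ j / j.factorial : ℝ) • c j) +
        rlIntegral α (fun s => A.mulVec (x s)) t := by
  induction k with
  | zero => exact ⟨0, continuousOn_const, fun t _ => by simp [rlIntegral]⟩
  | succ k ih =>
    obtain ⟨x, hx, h⟩ := ih
    have hk : (0 : ℝ) ≤ k := k.cast_nonneg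
    set y := mittagLeffler α k (k + 1) (fun l => (A ^ l).mulVec (c k)) with hy
    have hyc : ContinuousOn y (Icc 0 T) :=
      continuousOn_mittagLeffler hα hk (by positivity) (isGeomBounded_pow_mulVec A _)
    refine ⟨fun t => x t + y t, hx.add hyc, fun t ht => ?_⟩
    have hsub : Icc 0 t ⊆ Icc 0 T := Icc_subset_Icc_right ht.2
    have hA : Continuous fun v => A.mulVec v :=
      LinearMap.continuous_of_finiteDimensional A.mulVecLin
    have h1 := mittagLeffler_pow_mulVec_eq A (c k) hα hk ht.1
    rw [← hy, Real.rpow_natCast, Real.Gamma_nat_eq_factorial] at h1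
    have h2 : rlIntegral α (fun s => A.mulVec (x s) + A.mulVec (y s)) t =
        rlIntegral α (fun s => A.mulVec (x s)) t + rlIntegral α (fun s => A.mulVec (y s)) t :=
      rlIntegral_add hα.le ht.1 (hA.comp_continuousOn (hx.mono hsub))
        (hA.comp_continuousOn (hyc.mono hsub))
    simp only [Matrix.mulVec_add]
    rw [h2, Finset.sum_range_succ]
    conv_lhs => rw [h t ht, h1]
    abel

theorem controllable_of_rank {k : ℕ} {α T : ℝ} (hk : 1 ≤ k)
    (hα : (k : ℝ) - 1 < α) (hα' : α ≤ k) (hT : 0 < T) {A : Matrix (Fin n) (Fin n) ℝ}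
    {B : Matrix (Fin n) (Fin m) ℝ} (h : (controllabilityMatrix A B).rank = n) :
    Controllable k α A B T := by
  intro x₀ target
  have hk' : (1 : ℝ) ≤ k := by exact_mod_cast hk
  have hα0 : 0 < α := by linarith
  let c : ℕ → Fin n → ℝ := fun j => if hj : j < k then x₀ ⟨j, hj⟩ else 0
  have hc : (fun j : Fin k => c j) = x₀ := by
    ext1 j
    simp [c, j.2]
  obtain ⟨x, hx, hfree⟩ := exists_free_solution (T := T) hα0 A c k
  have hmem : target - x T ∈ reachable hα0 T A B := by
    rw [reachable_eq_top hα0 hT h]; trivial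
  obtain ⟨u, y, hu, hy, hyeq, hyT⟩ := hmem
  refine ⟨u, fun t => x t + y t, isAdmissible_of_continuous T hu, ?_, by simp [hyT]⟩
  rw [← hc]
  refine isTrajectory_of_integral_eq hk hα hα' hT A B hu.continuousOn (hx.add hy) fun t ht => ?_
  have hsub : Icc 0 t ⊆ Icc 0 T := Icc_subset_Icc_right ht.2
  have hA : Continuous fun v => A.mulVec v :=
    LinearMap.continuous_of_finiteDimensional A.mulVecLin
  have h1 : rlIntegral α (fun s => A.mulVec (x s) + (A.mulVec (y s) + B.mulVec (u s))) t =
      rlIntegral α (fun s => A.mulVec (x s)) t +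
        rlIntegral α (fun s => A.mulVec (y s) + B.mulVec (u s)) t :=
    rlIntegral_add hα0.le ht.1 (hA.comp_continuousOn (hx.mono hsub))
      ((continuousOn_mulVec_add A B hy hu).mono hsub)
  simp only [Pi.add_apply, Matrix.mulVec_add, add_assoc]
  rw [h1, ← hyeq t ht, ← add_assoc, ← hfree t ht]

end Reachability

section Gramian

variable {n m : ℕ}

theorem hasSum_evolution {α t : ℝ} (hα : 0 < α) (ht : 0 ≤ t) (A : Matrix (Fin n) (Fin n) ℝ) :
    HasSum (fun l : ℕ => (t ^ (α * (l : ℝ)) / Real.Gamma (α * (l : ℝ) + α)) • A ^ l)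
      (evolution α A t) := by
  apply Summable.hasSum
  refine Pi.summable.2 fun i => Pi.summable.2 fun j => ?_
  have hc := (isGeomBounded_pow_mulVec A (Pi.single j 1)).clm
    (ContinuousLinearMap.proj (R := ℝ) i)
  have h := summable_mittagLeffler (β := 0) hα le_rfl hα ht hc
  simpa using h

theorem isGeomBounded_vecMul (x : Fin n → ℝ) (A : Matrix (Fin n) (Fin n) ℝ)
    (B : Matrix (Fin n) (Fin m) ℝ) (j : Fin m) :
    IsGeomBounded fun l => Matrix.vecMul x (A ^ l * B) j := by
  let L : (Fin n → ℝ) →L[ℝ] ℝ := LinearMap.toContinuousLinearMap (dotProductBilin ℝ ℝ x)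
  have h := (isGeomBounded_pow_mulVec A (B.mulVec (Pi.single j 1))).clm L
  convert h using 2 with l
  simp only [L, LinearMap.coe_toContinuousLinearMap', Matrix.mulVec_mulVec]
  change _ = x ⬝ᵥ _
  rw [Matrix.dotProduct_mulVec]
  simp

theorem vecMul_evolution_mul {α t : ℝ} (hα : 0 < α) (ht : 0 ≤ t) (x : Fin n → ℝ)
    (A : Matrix (Fin n) (Fin n) ℝ) (B : Matrix (Fin n) (Fin m) ℝ) (j : Fin m) :
    Matrix.vecMul x (evolution α A t * B) j =
      mittagLeffler α 0 α (fun l => Matrix.vecMul x (A ^ l * B) j) t := by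
  let Λ : Matrix (Fin n) (Fin n) ℝ →ₗ[ℝ] ℝ :=
    { toFun := fun M => Matrix.vecMul x (M * B) j
      map_add' := fun M N => by simp [Matrix.add_mul, Matrix.vecMul_add]
      map_smul' := fun r M => by simp [Matrix.vecMul_smul] }
  have hcont : Continuous Λ := by
    change Continuous fun M : Matrix (Fin n) (Fin n) ℝ => Matrix.vecMul x (M * B) j
    simp only [Matrix.vecMul, dotProduct, Matrix.mul_apply]
    fun_prop
  have h := (hasSum_evolution hα ht A).map Λ hcont
  change Λ (evolution α A t) = _
  rw [← h.tsum_eq, mittagLeffler]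
  apply tsum_congr
  intro l
  simp [Λ, Matrix.vecMul_smul]

theorem continuousOn_vecMul_evolution_mul {α T : ℝ} (hα : 0 < α) (x : Fin n → ℝ)
    (A : Matrix (Fin n) (Fin n) ℝ) (B : Matrix (Fin n) (Fin m) ℝ) (j : Fin m) :
    ContinuousOn (fun t => Matrix.vecMul x (evolution α A t * B) j) (Icc 0 T) :=
  (continuousOn_mittagLeffler hα le_rfl hα (isGeomBounded_vecMul x A B j)).congr fun _ ht =>
    vecMul_evolution_mul hα ht.1 x A B j

/-- The quadratic form of the Gramian is the squared `L²` norm of `x ᵀ Φ_α B`. -/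
theorem dotProduct_gramian_mulVec {α T : ℝ} (hα : 0 < α) (hT : 0 ≤ T)
    (A : Matrix (Fin n) (Fin n) ℝ) (B : Matrix (Fin n) (Fin m) ℝ) (x : Fin n → ℝ) :
    x ⬝ᵥ (gramian α A B T).mulVec x =
      ∫ τ in (0 : ℝ)..T, ∑ j, (Matrix.vecMul x (evolution α A τ * B) j) ^ 2 := by
  have hentry : ∀ i i' τ, (evolution α A τ * B * B.transpose * (evolution α A τ).transpose) i i' =
      ∑ j, (evolution α A τ * B) i j * (evolution α A τ * B) i' j := by
    intro i i' τ
    rw [Matrix.mul_assoc, ← Matrix.transpose_mul, Matrix.mul_apply]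
    rfl
  have hc : ∀ i j, ContinuousOn (fun τ => (evolution α A τ * B) i j) (Icc 0 T) := by
    intro i j
    simpa using continuousOn_vecMul_evolution_mul (T := T) hα (Pi.single i 1) A B j
  have hint : ∀ i i', IntervalIntegrable (fun τ => x i * ((∑ j, (evolution α A τ * B) i j *
      (evolution α A τ * B) i' j) * x i')) volume 0 T := by
    intro i i'
    apply ContinuousOn.intervalIntegrable
    rw [uIcc_of_le hT]
    refine continuousOn_const.mul (ContinuousOn.mul ?_ continuousOn_const)
    exact continuousOn_finsetSum _ fun j _ => (hc i j).mul (hc i' j)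
  have hL : x ⬝ᵥ (gramian α A B T).mulVec x = ∑ i, ∑ i', ∫ τ in (0 : ℝ)..T,
      x i * ((∑ j, (evolution α A τ * B) i j * (evolution α A τ * B) i' j) * x i') := by
    simp only [dotProduct, Matrix.mulVec, Finset.mul_sum, gramian, Matrix.of_apply, hentry,
      intervalIntegral.integral_const_mul, intervalIntegral.integral_mul_const]
  have hsum : ∀ i, IntervalIntegrable (fun τ => ∑ i', x i * ((∑ j, (evolution α A τ * B) i j *
      (evolution α A τ * B) i' j) * x i')) volume 0 T := fun i => by
    simpa only [Finset.sum_fn] using IntervalIntegrable.sum Finset.univ fun i' _ => hint i i'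
  rw [hL]
  simp only [← intervalIntegral.integral_finsetSum (fun i' _ => hint _ i')]
  rw [← intervalIntegral.integral_finsetSum (fun i _ => hsum i)]
  congr 1
  ext τ
  simp only [Matrix.vecMul, dotProduct, sq, Finset.sum_mul_sum]
  symm
  rw [Finset.sum_comm]
  refine Finset.sum_congr rfl fun i _ => ?_
  rw [Finset.sum_comm]
  refine Finset.sum_congr rfl fun i' _ => ?_
  rw [Finset.sum_mul, Finset.mul_sum]
  exact Finset.sum_congr rfl fun j _ => by ring

theorem isHermitian_gramian (α T : ℝ) (A : Matrix (Fin n) (Fin n) ℝ)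
    (B : Matrix (Fin n) (Fin m) ℝ) : (gramian α A B T).IsHermitian := by
  ext i j
  simp only [Matrix.conjTranspose_apply, gramian, Matrix.of_apply, star_trivial]
  congr 1
  ext τ
  have h : (evolution α A τ * B * B.transpose * (evolution α A τ).transpose).transpose =
      evolution α A τ * B * B.transpose * (evolution α A τ).transpose := by
    simp only [Matrix.transpose_mul, Matrix.transpose_transpose, Matrix.mul_assoc]
  exact congrFun (congrFun h i) j

theorem posDef_gramian_iff {α T : ℝ} (hα : 0 < α) (hT : 0 < T) (A : Matrix (Fin n) (Fin n) ℝ)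
    (B : Matrix (Fin n) (Fin m) ℝ) :
    (gramian α A B T).PosDef ↔ (controllabilityMatrix A B).rank = n := by
  rw [rank_controllabilityMatrix_iff, Matrix.posDef_iff_dotProduct_mulVec]
  simp only [star_trivial, dotProduct_gramian_mulVec hα hT.le, isHermitian_gramian, true_and]
  constructor
  · intro h v hv
    by_contra hv0
    have h1 := h hv0
    rw [intervalIntegral.integral_congr (g := fun _ => 0)] at h1
    · simp at h1
    · intro τ hτ
      rw [uIcc_of_le hT.le] at hτ
      simp only [vecMul_evolution_mul hα hτ.1, hv]
      simp [mittagLeffler]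
  · intro h x hx
    have hex : ∃ t ∈ Icc 0 T, ∃ j, Matrix.vecMul x (evolution α A t * B) j ≠ 0 := by
      by_contra! hcon
      apply hx
      apply h
      intro l
      ext j
      refine eq_zero_of_mittagLeffler_eq_zero hα hT (isGeomBounded_vecMul x A B j) ?_ l
      intro t ht
      rw [← vecMul_evolution_mul hα ht.1, hcon t ht j]
    obtain ⟨t, ht, j, hj⟩ := hex
    apply intervalIntegral.integral_pos hT
    · exact continuousOn_finsetSum _ fun j _ =>
        (continuousOn_vecMul_evolution_mul hα x A B j).pow 2
    · intro τ _
      positivity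
    · refine ⟨t, ht, Finset.sum_pos' (fun _ _ => sq_nonneg _) ⟨j, Finset.mem_univ _, ?_⟩⟩
      positivity

end Gramian

end CaputoControl

theorem theorem4p9 {n m : ℕ} (A : Matrix (Fin n) (Fin n) ℝ) (B : Matrix (Fin n) (Fin m) ℝ) :
    (∀ (k : ℕ) (α T : ℝ), 1 ≤ k → (k : ℝ) - 1 < α → α ≤ k → 0 < T →
      List.TFAE [
        CaputoControl.Controllable k α A B T,
        ∀ T' : ℝ, 0 < T' → CaputoControl.Controllable k α A B T',
        (CaputoControl.controllabilityMatrix A B).rank = n,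
        ∀ z ∈ spectrum ℂ (A.map Complex.ofReal), (CaputoControl.pbhMatrix A B z).rank = n,
        (CaputoControl.gramian α A B T).PosDef,
        ∀ T' : ℝ, 0 < T' → (CaputoControl.gramian α A B T').PosDef]) ∧
    (∀ (k k' : ℕ) (α α' T T' : ℝ), 1 ≤ k → (k : ℝ) - 1 < α → α ≤ k → 0 < T →
      1 ≤ k' → (k' : ℝ) - 1 < α' → α' ≤ k' → 0 < T' →
      (CaputoControl.Controllable k α A B T ↔ CaputoControl.Controllable k' α' A B T')) := by
  have key : ∀ (k : ℕ) (α T : ℝ), 1 ≤ k → (k : ℝ) - 1 < α → α ≤ k → 0 < T →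
      (CaputoControl.Controllable k α A B T ↔ (CaputoControl.controllabilityMatrix A B).rank = n) :=
    fun k α T hk hα hα' hT =>
      ⟨fun h => CaputoControl.rank_controllabilityMatrix_of_rank_pbhMatrix A B fun z _ =>
        CaputoControl.rank_pbhMatrix_of_controllable hk hα hα' hT h z,
      CaputoControl.controllable_of_rank hk hα hα' hT⟩
  constructor
  · intro k α T hk hα hα' hT
    have hk' : (1 : ℝ) ≤ k := by exact_mod_cast hk
    have hα0 : 0 < α := by linarith
    tfae_have 1 ↔ 3 := key k α T hk hα hα' hT
    tfae_have 2 → 1 := fun h => h T hT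
    tfae_have 3 → 2 := fun h T' hT' => (key k α T' hk hα hα' hT').2 h
    tfae_have 1 → 4 := fun h z _ =>
      CaputoControl.rank_pbhMatrix_of_controllable hk hα hα' hT h z
    tfae_have 4 → 3 := CaputoControl.rank_controllabilityMatrix_of_rank_pbhMatrix A B
    tfae_have 5 ↔ 3 := CaputoControl.posDef_gramian_iff hα0 hT A B
    tfae_have 6 → 5 := fun h => h T hT
    tfae_have 3 → 6 := fun h T' hT' => (CaputoControl.posDef_gramian_iff hα0 hT' A B).2 h
    tfae_finish
  · intro k k' α α' T T' hk hα hα' hT hk' hβ hβ' hT'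
    exact (key k α T hk hα hα' hT).trans (key k' α' T' hk' hβ hβ' hT').symm
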